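/- **Setting.** Fix $k\ge 0$ underlay chains, at least two possible transactions, at least two clients, a network delay bound $\Delta>0$ and an underlay latency bound $T>0$; time is discrete. Underlay chains host deterministic smart contracts, are certificate-generating, and proceed in epochs of fixed duration. In a partially synchronous execution the adversary chooses the global stabilization time $\mathsf{GST}$, the inputs, the certified ledgers of each chain, and the ledger of each chain in the view of each observer (the clients, who may go online and offline at will, and the honest validators of each chain). Certified ledgers are valid: they record only transactions that were input by the environment, epochs that have started, and messages that were emitted earlier by the contract of some chain on a certified ledger of that chain. A chain is *safe* if all its certified ledgers are consistent (one is a prefix of the other) and the view of each observer only grows. A chain is *live* if each transaction input to its honest validators at time $t$, and each epoch starting at time $t$, is in its ledger for all observers from time $\max(\mathsf{GST},t)+T$ on, and each message that its validators read at time $t$ on the ledger of a chain is so from time $\max(\mathsf{GST},t)+\Delta+T$ on. An *overlay protocol* $\Pi$ consists of a contract for each chain and a rule by which clients compute an overlay ledger from their views of the underlay ledgers; clients never output a transaction that has not been input to any chain. It is *safe* in an execution if the overlay ledgers output by all clients at all times are consistent and those of each client only grow, and *live* with latency $T'$ if each transaction input to all chains at time $t$ is in the overlay ledger of every client at all times $\ge\max(\mathsf{GST},t)+T'$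 at which it is online. For $s,l\in\{0,1\}^k$ write $\mathrm{ind}(s)=\{i: s_i=1\}$, and order $\{0,1\}^{2k}$ componentwise. Let $V^S_\Pi$ be the set of $(s,l)$ such that $\Pi$ is safe in all executions in which all chains in $\mathrm{ind}(s)$ are safe and all chains in $\mathrm{ind}(l)$ are live, and $V^L_\Pi$ the set of $(s,l)$ such that, for some constant $T'$, $\Pi$ is live with latency $T'$ in all these executions. Let $E^S_\Pi,E^L_\Pi$ be the sets of minimal elements of $V^S_\Pi,V^L_\Pi$; $\Pi$ is *characterized* by $(E^S_\Pi,E^L_\Pi)$. $\Pi$ is *Pareto-optimal* if there is no $\Pi'$ with $V^S_\Pi\subseteq V^S_{\Pi'}$ and $V^L_\Pi\subseteq V^L_{\Pi'}$, at least one of the inclusions being strict. A tuple $(E^S,E^L)$ of subsets of $\{0,1\}^{2k}$ *dominates* $(\tilde E^S,\tilde E^L)$ if the upward closures of $E^S$ and $E^L$ contain those of $\tilde E^S$ and $\tilde E^L$ respectively. **Theorem.** Let $\mathcal T$ be the set of tuples $(E^S,E^L)$ of subsets of $\{0,1\}^{2k}$ such that 1. $l=0^k$ for all $(s,l)\in E^S$,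 and $s'=0^k$ for all $(s',l')\in E^L$; 2. $\mathrm{ind}(l^1)\cap\mathrm{ind}(l^2)\cap\mathrm{ind}(s)\ne\emptyset$ for all $(0^k,l^1),(0^k,l^2)\in E^L$ and $(s,0^k)\in E^S$, and $l\neq 0^k$ for all $(0^k,l)\in E^L$ (the latter follows from the former unless $E^S=\emptyset$); 3. for all $(s,0^k)\in E^S$ and all $s'<s$ there are $(0^k,l^1),(0^k,l^2)\in E^L$ with $\mathrm{ind}(l^1)\cap\mathrm{ind}(l^2)\cap\mathrm{ind}(s')=\emptyset$. Then, under partial synchrony: * (a) every Pareto-optimal overlay protocol is characterized by a tuple in $\mathcal T$; * (b) for every tuple in $\mathcal T$ there is a Pareto-optimal overlay protocol characterized by a tuple dominating it; * (c) the Pareto-optimal overlay protocols are exactly the overlay protocols characterized by a tuple in $\mathcal T$ that is maximal in $\mathcal T$ with respect to dominance. -/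

import Mathlib

open Set

universe u v

namespace Interchain

/-! ### Ledgers -/

/-- An item finalized on the ledger of an underlay chain: a transaction of the environment, the mark
of the epoch that starts at time `τ` (underlay chains proceed in epochs of fixed duration, so that
smart contracts can keep track of time), or a message that was emitted on chain `j` and has been
relayed by the cross-chain communication together with a certificate. -/
inductive Entry (k : ℕ) (Tx Msg : Type u) : Type u
  | tx (x : Tx)
  | epoch (τ : ℕ)
  | msg (j : Fin k) (m : Msg)

abbrev Ledger (k : ℕ) (Tx Msg : Type u) : Type u := List (Entry k Tx Msg)

/-- Two ledgers are consistent if one of them is a prefix of the other. -/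
def Consistent {α : Type*} (L L' : List α) : Prop := L <+: L' ∨ L' <+: L

/-! ### The code of an overlay protocol -/

/-- The code of an interchain protocol on top of `k` underlay chains. `emit i L` is what the smart
contract on chain `i` emits when the last entry of the ledger `L` has been executed. `read` is the
rule by which a client computes its overlay ledger from nothing but the views of the underlay
ledgers it had (each with the time at which it had them). -/
structure Code (k : ℕ) (Tx : Type u) where
  Msg : Type u
  emit : Fin k → Ledger k Tx Msg → List Msg
  read : List (ℕ × (Fin k → Ledger k Tx Msg)) → List Tx

namespace Code

variable {k : ℕ} {Tx : Type u}

/-- The message `m` is emitted in the course of executing the ledger `L` of chain `j`. -/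
def Emitted (P : Code k Tx) (j : Fin k) (L : Ledger k Tx P.Msg) (m : P.Msg) : Prop :=
  ∃ L₀, L₀ <+: L ∧ m ∈ P.emit j L₀

end Code

/-! ### Executions under partial synchrony -/

/-- Those who read the underlay ledgers: the clients, and for each chain its honest validators,
who share what they see. -/
abbrev Observer (k : ℕ) (Client : Type v) : Type v := Client ⊕ Fin k

/-- An execution of the code `P` over `k` underlay chains, in discrete time, as chosen by the
adversary. -/
structure Execution {k : ℕ} {Tx : Type u} (P : Code k Tx) (Client : Type v) where
  /-- the global stabilization time -/
  gst : ℕ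
  /-- `input i x t`: the environment inputs `x` to all honest validators of chain `i` at time `t` -/
  input : Fin k → Tx → ℕ → Prop
  /-- the ledgers of chain `i` for which a certificate of finality exists by time `t` -/
  cert : Fin k → ℕ → Set (Ledger k Tx P.Msg)
  /-- the ledger of chain `i` in the view of an observer at time `t` -/
  view : Observer k Client → Fin k → ℕ → Ledger k Tx P.Msg
  /-- the times at which a client is online -/
  online : Client → Set ℕ
  view_mem : ∀ o i t, view o i t ∈ cert i t
  cert_mono : ∀ i t t', t ≤ t' → cert i t ⊆ cert i t'
  cert_prefix : ∀ i t L L', L' ∈ cert i t → L <+: L' → L ∈ cert i t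
  /-- only transactions of the environment can be recorded -/
  cert_tx : ∀ i t L x, L ++ [Entry.tx x] ∈ cert i t → ∃ j, ∃ t' ≤ t, input j x t'
  /-- an epoch is not recorded before it starts -/
  cert_epoch : ∀ i t L τ, L ++ [Entry.epoch τ] ∈ cert i t → τ ≤ t
  /-- only messages emitted earlier on a certified ledger of the sending chain can be recorded -/
  cert_msg : ∀ i t L j m, L ++ [Entry.msg j m] ∈ cert i t →
    ∃ t' < t, ∃ L' ∈ cert j t', P.Emitted j L' m

namespace Execution

variable {k : ℕ} {Tx : Type u} {P : Code k Tx} {Client : Type v}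

/-- Chain `i` is safe (and, being certificate-generating, has no conflicting certified ledgers). -/
def ChainSafe (e : Execution P Client) (i : Fin k) : Prop :=
  (∀ t t', ∀ L ∈ e.cert i t, ∀ L' ∈ e.cert i t', Consistent L L') ∧
  (∀ o t t', t ≤ t' → e.view o i t <+: e.view o i t')

/-- Chain `i` is live with latency `T` after `gst`: whatever is input to its honest validators at
time `t` is in its ledger, for all observers, at all times from `max gst t + T` on. The inputs are
the transactions of the environment, the epochs, and the messages that the validators of `i` read
on the ledgers of the chains, which reach all of them within the network delay `Δ` after `gst`. -/
structure ChainLive (e : Execution P Client) (Δ T : ℕ) (i : Fin k) : Prop where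
  tx : ∀ x t, e.input i x t → ∀ o t', max e.gst t + T ≤ t' → Entry.tx x ∈ e.view o i t'
  epoch : ∀ τ o t', max e.gst τ + T ≤ t' → Entry.epoch τ ∈ e.view o i t'
  msg : ∀ j m t, P.Emitted j (e.view (Sum.inr i) j t) m →
    ∀ o t', max e.gst t + Δ + T ≤ t' → Entry.msg j m ∈ e.view o i t'

open Classical in
/-- The views that the client `c` had at the times `≤ t` at which it was online. -/
noncomputable def history (e : Execution P Client) (c : Client) (t : ℕ) :
    List (ℕ × (Fin k → Ledger k Tx P.Msg)) :=
  ((List.range (t + 1)).filter (fun t' => decide (t' ∈ e.online c))).map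
    (fun t' => (t', fun i => e.view (Sum.inl c) i t'))

/-- The overlay ledger that the client `c` outputs at time `t`. -/
noncomputable def overlayLedger (e : Execution P Client) (c : Client) (t : ℕ) : List Tx :=
  P.read (e.history c t)

/-- The overlay protocol is safe in the execution. -/
def OverlaySafe (e : Execution P Client) : Prop :=
  (∀ c c' t t', t ∈ e.online c → t' ∈ e.online c' →
    Consistent (e.overlayLedger c t) (e.overlayLedger c' t')) ∧
  (∀ c t t', t ∈ e.online c → t' ∈ e.online c → t ≤ t' →
    e.overlayLedger c t <+: e.overlayLedger c t')

/-- The overlay protocol is live with latency `T` after `gst` in the execution. -/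
def OverlayLive (e : Execution P Client) (T : ℕ) : Prop :=
  ∀ x t, (∀ i, e.input i x t) → ∀ c, ∀ t' ∈ e.online c, max e.gst t + T ≤ t' →
    x ∈ e.overlayLedger c t'

end Execution

/-! ### Overlay protocols and their security -/

/-- An overlay protocol orders transactions of the environment: clients never output a transaction
that has not been input to the validators of any chain. -/
structure OverlayProtocol (k : ℕ) (Tx : Type u) (Client : Type v) extends Code k Tx where
  valid : ∀ (e : Execution toCode Client) (c : Client), ∀ t ∈ e.online c,
    ∀ x ∈ e.overlayLedger c t, ∃ i, ∃ t' ≤ t, e.input i x t'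

/-- The elements `(s, l)` of `{0,1}^{2k}`. -/
abbrev Guarantee (k : ℕ) : Type := (Fin k → Bool) × (Fin k → Bool)

/-- `ind s = {i | s_i = 1}`. -/
def ind {k : ℕ} (s : Fin k → Bool) : Set (Fin k) := {i | s i = true}

/-- The extreme elements of `V`. -/
def exm {k : ℕ} (V : Set (Guarantee k)) : Set (Guarantee k) := {v | v ∈ V ∧ ¬ ∃ w ∈ V, w < v}

namespace OverlayProtocol

variable {k : ℕ} {Tx : Type u} {Client : Type v}

/-- `V^S`: the pairs `(s, l)` such that the overlay protocol is safe whenever the chains in `ind s`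
are safe and those in `ind l` are live. -/
def VS (Δ T : ℕ) (P : OverlayProtocol k Tx Client) : Set (Guarantee k) :=
  {p | ∀ e : Execution P.toCode Client,
    (∀ i ∈ ind p.1, e.ChainSafe i) → (∀ i ∈ ind p.2, e.ChainLive Δ T i) → e.OverlaySafe}

/-- `V^L`: the pairs `(s, l)` such that the overlay protocol is live, with a constant latency,
whenever the chains in `ind s` are safe and those in `ind l` are live. -/
def VL (Δ T : ℕ) (P : OverlayProtocol k Tx Client) : Set (Guarantee k) :=
  {p | ∃ T' : ℕ, ∀ e : Execution P.toCode Client,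
    (∀ i ∈ ind p.1, e.ChainSafe i) → (∀ i ∈ ind p.2, e.ChainLive Δ T i) → e.OverlayLive T'}

/-- `E^S`. -/
def ES (Δ T : ℕ) (P : OverlayProtocol k Tx Client) : Set (Guarantee k) := exm (P.VS Δ T)

/-- `E^L`. -/
def EL (Δ T : ℕ) (P : OverlayProtocol k Tx Client) : Set (Guarantee k) := exm (P.VL Δ T)

def StrictlyDominates (Δ T : ℕ) (P P' : OverlayProtocol k Tx Client) : Prop :=
  P'.VS Δ T ⊆ P.VS Δ T ∧ P'.VL Δ T ⊆ P.VL Δ T ∧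
    (P'.VS Δ T ⊂ P.VS Δ T ∨ P'.VL Δ T ⊂ P.VL Δ T)

def ParetoOptimal (Δ T : ℕ) (P : OverlayProtocol k Tx Client) : Prop :=
  ¬ ∃ P' : OverlayProtocol k Tx Client, StrictlyDominates Δ T P' P

end OverlayProtocol

/-! ### The tuples `(E^S, E^L)` -/

/-- The upward closure of `E`, that is, the set `V` described by the elements of `E`. -/
def up {k : ℕ} (E : Set (Guarantee k)) : Set (Guarantee k) := {v | ∃ w ∈ E, w ≤ v}

/-- The tuple `A = (E^S, E^L)` dominates the tuple `B`. -/
def TupleDominates {k : ℕ} (A B : Set (Guarantee k) × Set (Guarantee k)) : Prop :=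
  up B.1 ⊆ up A.1 ∧ up B.2 ⊆ up A.2

/-- The conditions on a tuple `A = (E^S, E^L)`. -/
structure Admissible {k : ℕ} (A : Set (Guarantee k) × Set (Guarantee k)) : Prop where
  /-- safety depends on safety only -/
  safety_decoupled : ∀ p ∈ A.1, p.2 = fun _ => false
  /-- liveness depends on liveness only -/
  liveness_decoupled : ∀ q ∈ A.2, q.1 = fun _ => false
  /-- liveness needs at least one live chain (this follows from the next condition unless `E^S` is
  empty) -/
  quorum_nonempty : ∀ q ∈ A.2, (ind q.2).Nonempty
  /-- two liveness quorums and a safety set have a chain in common -/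
  intersection : ∀ q₁ ∈ A.2, ∀ q₂ ∈ A.2, ∀ p ∈ A.1, (ind q₁.2 ∩ ind q₂.2 ∩ ind p.1).Nonempty
  /-- the safety sets are minimal with respect to this -/
  minimality : ∀ p ∈ A.1, ∀ s' < p.1, ∃ q₁ ∈ A.2, ∃ q₂ ∈ A.2, ind q₁.2 ∩ ind q₂.2 ∩ ind s' = ∅

end Interchain

namespace Interchain

/-! ### Extreme elements and dominance -/

section Tuples

variable {k : ℕ}

/-! Two bounds carry the theorem. By `exists_admissible_upper`, the guarantees of any protocol lie
in the upward closures of some admissible tuple; by `exists_protocol_lower`, every admissible tuple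
is met or exceeded by some protocol. As there are finitely many pairs of upward closures,
Pareto-optimality then amounts to maximality among admissible tuples.

The upper bound is a split-brain argument. Suppose `p ∈ V^S` and `q₁, q₂ ∈ V^L` have no chain in
`ind q₁.2 ∩ ind q₂.2 ∩ ind p.1`. Until GST, one client sees a world where only `x` is input and only
the chains of `q₁` are live, another client a world with `y` and `q₂` instead. A chain that is not
live in a world has an empty ledger there, so only chains live in both worlds must fork, and none of
them is in `p.1`. After GST all chains are live, so `p` promises safety; but liveness and validity
force one client to output copies of `x` only and the other copies of `y` only. The liveness part of
`p` and the safety parts of `q₁, q₂` play no role, which explains the decoupling.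

For the lower bound, contracts report their whole ledgers, and clients evaluate a leader-based
consensus protocol on what they see, with recorded epochs as the clock. A chain caught forking is
exposed and counts as a voter for everything; an unexposed chain votes at most once per phase. The
triple intersection condition thus replaces the usual quorum intersection and gives agreement. For
liveness there are two cases. If every safety set contains an exposed chain, the client may output
all it has seen. Otherwise some safety set has no exposed chain and meets the live quorum in a live,
unexposed chain, whose next phase as leader commits. -/

theorem up_exm {V : Set (Guarantee k)} (hV : IsUpperSet V) : up (exm V) = V := by
  ext v
  constructor
  · rintro ⟨w, hw, hwv⟩
    exact hV hwv hw.1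
  · intro hv
    obtain ⟨w, hwv, hw⟩ := (Set.toFinite V).exists_le_minimal hv
    exact ⟨w, ⟨hw.prop, fun ⟨u, hu, huw⟩ => hw.not_lt hu huw⟩, hwv⟩

theorem isUpperSet_up (E : Set (Guarantee k)) : IsUpperSet (up E) :=
  fun _ _ h ⟨w, hw, hwa⟩ => ⟨w, hw, hwa.trans h⟩

theorem exm_up_subset (E : Set (Guarantee k)) : exm (up E) ⊆ E := by
  rintro v ⟨⟨w, hw, hwv⟩, hmin⟩
  rcases hwv.lt_or_eq with h | rfl
  · exact absurd ⟨w, ⟨w, hw, le_rfl⟩, h⟩ hmin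
  · exact hw

theorem ind_mono {s s' : Fin k → Bool} (h : s ≤ s') : ind s ⊆ ind s' := by
  intro i hi
  have := h i
  simp only [ind, mem_ofPred_eq] at *
  rw [hi] at this
  exact top_le_iff.1 this

theorem Admissible.exm_up {A : Set (Guarantee k) × Set (Guarantee k)} (hA : Admissible A) :
    Admissible (exm (up A.1), exm (up A.2)) where
  safety_decoupled p hp := hA.safety_decoupled p (exm_up_subset _ hp)
  liveness_decoupled q hq := hA.liveness_decoupled q (exm_up_subset _ hq)
  quorum_nonempty q hq := hA.quorum_nonempty q (exm_up_subset _ hq)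
  intersection q₁ h₁ q₂ h₂ p hp := hA.intersection q₁ (exm_up_subset _ h₁) q₂ (exm_up_subset _ h₂) p
    (exm_up_subset _ hp)
  minimality p hp s' hs' := by
    obtain ⟨q₁, h₁, q₂, h₂, h⟩ := hA.minimality p (exm_up_subset _ hp) s' hs'
    -- Replacing quorums by smaller extreme ones keeps an empty intersection empty, so minimality
    -- survives.
    have key : ∀ q ∈ A.2, ∃ q' ∈ exm (up A.2), q' ≤ q := fun q hq => by
      have : q ∈ up (exm (up A.2)) := by
        rw [up_exm (isUpperSet_up _)]
        exact ⟨q, hq, le_rfl⟩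
      exact this
    obtain ⟨q₁', h₁', hle₁⟩ := key q₁ h₁
    obtain ⟨q₂', h₂', hle₂⟩ := key q₂ h₂
    refine ⟨q₁', h₁', q₂', h₂', subset_empty_iff.1 (h ▸ ?_)⟩
    exact inter_subset_inter_left _ (inter_subset_inter (ind_mono hle₁.2) (ind_mono hle₂.2))

end Tuples

namespace OverlayProtocol

variable {k : ℕ} {Tx : Type u} {Client : Type v} {Δ T : ℕ}

theorem isUpperSet_VS (P : OverlayProtocol k Tx Client) : IsUpperSet (P.VS Δ T) :=
  fun _ _ h hp e hs hl => hp e (fun i hi => hs i (ind_mono h.1 hi)) fun i hi =>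
    hl i (ind_mono h.2 hi)

theorem isUpperSet_VL (P : OverlayProtocol k Tx Client) : IsUpperSet (P.VL Δ T) :=
  fun _ _ h ⟨T', hp⟩ => ⟨T', fun e hs hl => hp e (fun i hi => hs i (ind_mono h.1 hi)) fun i hi =>
    hl i (ind_mono h.2 hi)⟩

theorem up_ES (P : OverlayProtocol k Tx Client) : up (P.ES Δ T) = P.VS Δ T :=
  up_exm P.isUpperSet_VS

theorem up_EL (P : OverlayProtocol k Tx Client) : up (P.EL Δ T) = P.VL Δ T :=
  up_exm P.isUpperSet_VL

theorem ParetoOptimal.eq {P Q : OverlayProtocol k Tx Client} (hP : P.ParetoOptimal Δ T)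
    (hS : P.VS Δ T ⊆ Q.VS Δ T) (hL : P.VL Δ T ⊆ Q.VL Δ T) :
    P.VS Δ T = Q.VS Δ T ∧ P.VL Δ T = Q.VL Δ T := by
  constructor
  · by_contra hne
    exact hP ⟨Q, hS, hL, Or.inl (hS.ssubset_of_ne hne)⟩
  · by_contra hne
    exact hP ⟨Q, hS, hL, Or.inr (hL.ssubset_of_ne hne)⟩

end OverlayProtocol

/-! ### Reduction of the theorem to an upper and a lower bound -/

section Characterization

variable {k : ℕ} {Tx : Type u} {Client : Type v} {Δ T : ℕ}
  (upper : ∀ P : OverlayProtocol k Tx Client,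
    ∃ A, Admissible A ∧ P.VS Δ T ⊆ up A.1 ∧ P.VL Δ T ⊆ up A.2)
  (lower : ∀ A : Set (Guarantee k) × Set (Guarantee k), Admissible A →
    ∃ Q : OverlayProtocol k Tx Client, up A.1 ⊆ Q.VS Δ T ∧ up A.2 ⊆ Q.VL Δ T)

include upper in
theorem OverlayProtocol.paretoOptimal_of_maximal {P : OverlayProtocol k Tx Client}
    (hmax : ∀ A, Admissible A → P.VS Δ T ⊆ up A.1 → P.VL Δ T ⊆ up A.2 →
      up A.1 ⊆ P.VS Δ T ∧ up A.2 ⊆ P.VL Δ T) : P.ParetoOptimal Δ T := by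
  rintro ⟨Q, hS, hL, hlt⟩
  obtain ⟨A, hA, hAS, hAL⟩ := upper Q
  obtain ⟨h₁, h₂⟩ := hmax A hA (hS.trans hAS) (hL.trans hAL)
  rcases hlt with h | h
  · exact h.2 (hAS.trans h₁)
  · exact h.2 (hAL.trans h₂)

include upper lower in
theorem OverlayProtocol.ParetoOptimal.admissible {P : OverlayProtocol k Tx Client}
    (hP : P.ParetoOptimal Δ T) : Admissible (P.ES Δ T, P.EL Δ T) := by
  -- `A` is squeezed between `P` and `Q`, and optimality of `P` collapses the sandwich.
  obtain ⟨A, hA, hAS, hAL⟩ := upper P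
  obtain ⟨Q, hQS, hQL⟩ := lower A hA
  obtain ⟨h₁, h₂⟩ := hP.eq (hAS.trans hQS) (hAL.trans hQL)
  have hS : P.VS Δ T = up A.1 := hAS.antisymm (h₁ ▸ hQS)
  have hL : P.VL Δ T = up A.2 := hAL.antisymm (h₂ ▸ hQL)
  have := hA.exm_up
  rwa [← hS, ← hL] at this

include upper lower in
theorem exists_paretoOptimal_dominating {A : Set (Guarantee k) × Set (Guarantee k)}
    (hA : Admissible A) : ∃ P : OverlayProtocol k Tx Client, P.ParetoOptimal Δ T ∧
      TupleDominates (P.ES Δ T, P.EL Δ T) A := by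
  -- Dominance is only a preorder on tuples; passing to upward closures makes it a partial order on
  -- a finite set, so maximal elements exist.
  let U : Set (Set (Guarantee k) × Set (Guarantee k)) :=
    {V | ∃ A, Admissible A ∧ V = (up A.1, up A.2)}
  obtain ⟨V, hle, hV⟩ := (Set.toFinite U).exists_le_maximal (a := (up A.1, up A.2)) ⟨A, hA, rfl⟩
  obtain ⟨B, hB, rfl⟩ := hV.prop
  obtain ⟨Q, hQS, hQL⟩ := lower B hB
  refine ⟨Q, ?_, ?_⟩
  · refine OverlayProtocol.paretoOptimal_of_maximal upper fun C hC hS hL => ?_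
    have := hV.le_of_ge (y := (up C.1, up C.2)) ⟨C, hC, rfl⟩ ⟨hQS.trans hS, hQL.trans hL⟩
    exact ⟨this.1.trans hQS, this.2.trans hQL⟩
  · refine ⟨?_, ?_⟩
    · simp only [OverlayProtocol.up_ES]
      exact hle.1.trans hQS
    · simp only [OverlayProtocol.up_EL]
      exact hle.2.trans hQL

include upper lower in
theorem OverlayProtocol.paretoOptimal_iff (P : OverlayProtocol k Tx Client) :
    P.ParetoOptimal Δ T ↔ Admissible (P.ES Δ T, P.EL Δ T) ∧
      ∀ A : Set (Guarantee k) × Set (Guarantee k), Admissible A →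
        TupleDominates A (P.ES Δ T, P.EL Δ T) → TupleDominates (P.ES Δ T, P.EL Δ T) A := by
  simp only [TupleDominates, P.up_ES, P.up_EL]
  refine ⟨fun hP => ⟨hP.admissible upper lower, fun A hA ⟨hS, hL⟩ => ?_⟩, fun ⟨_, hmax⟩ =>
    paretoOptimal_of_maximal upper fun A hA hS hL => hmax A hA ⟨hS, hL⟩⟩
  obtain ⟨Q, hQS, hQL⟩ := lower A hA
  obtain ⟨h₁, h₂⟩ := hP.eq (hS.trans hQS) (hL.trans hQL)
  exact ⟨h₁ ▸ hQS, h₂ ▸ hQL⟩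

end Characterization

/-! ### Executions in which the ledgers grow step by step -/

theorem Consistent.of_prefix {α : Type*} {L L' M : List α} (h : L <+: M) (h' : L' <+: M) :
    Consistent L L' := List.prefix_or_prefix_of_prefix h h'

namespace Code

variable {k : ℕ} {Tx : Type u} (P : Code k Tx)

/-- Everything that is input to a chain by time `t`, if `X` are the transactions and the validators
see the ledgers `V`. -/
def batch (X : List Tx) (t : ℕ) (V : Fin k → Ledger k Tx P.Msg) : Ledger k Tx P.Msg :=
  (List.range (t + 1)).map Entry.epoch ++ X.map Entry.tx ++
    (List.finRange k).flatMap fun j => ((V j).inits.flatMap (P.emit j)).map (Entry.msg j)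

variable {P} in
theorem epoch_mem_batch {X : List Tx} {t : ℕ} {V : Fin k → Ledger k Tx P.Msg} {τ : ℕ} :
    Entry.epoch τ ∈ P.batch X t V ↔ τ ≤ t := by
  simp [batch]

variable {P} in
theorem tx_mem_batch {X : List Tx} {t : ℕ} {V : Fin k → Ledger k Tx P.Msg} {x : Tx} :
    Entry.tx x ∈ P.batch X t V ↔ x ∈ X := by
  simp [batch]

variable {P} in
theorem msg_mem_batch {X : List Tx} {t : ℕ} {V : Fin k → Ledger k Tx P.Msg} {j : Fin k}
    {m : P.Msg} : Entry.msg j m ∈ P.batch X t V ↔ P.Emitted j (V j) m := by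
  simp [batch, Emitted]

/-- The ledgers given by `V` up to time `t₀`; afterwards those of the chains in `l` are live. -/
def evolve (X : List Tx) (l : Fin k → Bool) (t₀ : ℕ) (V : ℕ → Fin k → Ledger k Tx P.Msg) :
    ℕ → Fin k → Ledger k Tx P.Msg
  | 0 => V 0
  | t + 1 => if t + 1 ≤ t₀ then V (t + 1) else fun i =>
      if l i then evolve X l t₀ V t i ++ P.batch X (t + 1) (evolve X l t₀ V t)
      else evolve X l t₀ V t i

section Evolve

variable {P} {X : List Tx} {l : Fin k → Bool} {t₀ : ℕ} {V : ℕ → Fin k → Ledger k Tx P.Msg}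

theorem evolve_of_le {t : ℕ} (h : t ≤ t₀) : P.evolve X l t₀ V t = V t := by
  cases t with
  | zero => rfl
  | succ t => simp [evolve, h]

theorem evolve_succ {t : ℕ} (h : t₀ ≤ t) {i : Fin k} (hi : l i = true) :
    P.evolve X l t₀ V (t + 1) i =
      P.evolve X l t₀ V t i ++ P.batch X (t + 1) (P.evolve X l t₀ V t) := by
  rw [evolve, if_neg (by omega), if_pos hi]

theorem evolve_of_not_live {i : Fin k} (hi : l i = false) (t : ℕ) :
    P.evolve X l 0 V t i = V 0 i := by
  induction t with
  | zero => rfl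
  | succ t ih => simp [evolve, hi, ih]

theorem evolve_mono {i : Fin k} (hV : ∀ t t', t ≤ t' → t' ≤ t₀ → V t i <+: V t' i) {t t' : ℕ}
    (h : t ≤ t') : P.evolve X l t₀ V t i <+: P.evolve X l t₀ V t' i := by
  induction t', h using Nat.le_induction with
  | base => exact List.prefix_rfl
  | succ n hn ih =>
    by_cases h : n + 1 ≤ t₀
    · rw [evolve_of_le h, evolve_of_le (by omega)]
      exact hV _ _ (by omega) h
    · refine ih.trans ?_
      conv_rhs => rw [evolve, if_neg h]
      split
      · exact List.prefix_append _ _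
      · exact List.prefix_rfl

/-- A live chain appends all pending input at every step, repetitions included, so each item appears
after one step and stays. -/
theorem batch_subset_evolve {i : Fin k} (hV : ∀ t t', t ≤ t' → t' ≤ t₀ → V t i <+: V t' i)
    (hi : l i = true) {t t' : ℕ} (h₀ : t₀ ≤ t) (h : t < t') :
    P.batch X (t + 1) (P.evolve X l t₀ V t) ⊆ P.evolve X l t₀ V t' i := by
  refine List.Subset.trans ?_ (evolve_mono hV (Nat.succ_le_of_lt h)).subset
  rw [evolve_succ h₀ hi]
  exact List.subset_append_right _ _

theorem mem_evolve {i : Fin k} {t : ℕ} {a : Entry k Tx P.Msg} (ha : a ∈ P.evolve X l t₀ V t i) :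
    (∃ t' ≤ t, t' ≤ t₀ ∧ a ∈ V t' i) ∨
      ∃ t' < t, a ∈ P.batch X (t' + 1) (P.evolve X l t₀ V t') := by
  induction t with
  | zero => exact Or.inl ⟨0, le_rfl, Nat.zero_le _, ha⟩
  | succ t ih =>
    have ih' (h : a ∈ P.evolve X l t₀ V t i) : (∃ t' ≤ t + 1, t' ≤ t₀ ∧ a ∈ V t' i) ∨
        ∃ t' < t + 1, a ∈ P.batch X (t' + 1) (P.evolve X l t₀ V t') := (ih h).imp
      (fun ⟨t', h, h'⟩ => ⟨t', h.trans (Nat.le_succ t), h'⟩)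
        (fun ⟨t', h, h'⟩ => ⟨t', h.trans (Nat.lt_succ_self t), h'⟩)
    by_cases h : t + 1 ≤ t₀
    · rw [evolve_of_le h] at ha
      exact Or.inl ⟨t + 1, le_rfl, h, ha⟩
    · rw [evolve, if_neg h] at ha
      split at ha
      · rcases List.mem_append.1 ha with ha | ha
        · exact ih' ha
        · exact Or.inr ⟨t, by omega, ha⟩
      · exact ih' ha

end Evolve

/-- The entry `a` can be recorded at time `t`, if the transactions `X` are input at time `0` and the
ledgers `F w t` have a certificate by time `t`. -/
def Recordable (X : List Tx) {ι : Type*} (F : ι → ℕ → Fin k → Ledger k Tx P.Msg) (t : ℕ) :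
    Entry k Tx P.Msg → Prop
  | .tx x => x ∈ X
  | .epoch τ => τ ≤ t
  | .msg j m => ∃ t' < t, ∃ w, P.Emitted j (F w t' j) m

variable {P} in
theorem recordable_of_mem_batch {X X' : List Tx} (hX : X ⊆ X') {ι : Type*}
    {F : ι → ℕ → Fin k → Ledger k Tx P.Msg} {t t' : ℕ} (h : t < t') (w : ι)
    {a : Entry k Tx P.Msg} (ha : a ∈ P.batch X (t + 1) (F w t)) : P.Recordable X' F t' a := by
  cases a with
  | tx x => exact hX (tx_mem_batch.1 ha)
  | epoch τ => exact (epoch_mem_batch.1 ha).trans h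
  | msg j m => exact ⟨t, h, w, msg_mem_batch.1 ha⟩

end Code

namespace Execution

variable {k : ℕ} {Tx : Type u} {P : Code k Tx} {Client : Type v}

/-- The execution in which the certified ledgers are those of the family `F`, and the observer `o`
sees those with index `sel o t` at time `t`. -/
@[simps]
def ofFamily (gst : ℕ) (X : List Tx) {ι : Type*} (F : ι → ℕ → Fin k → Ledger k Tx P.Msg)
    (sel : Observer k Client → ℕ → ι) (i₀ : Fin k)
    (hmono : ∀ w i t t', t ≤ t' → F w t i <+: F w t' i)
    (hF : ∀ w i t, ∀ a ∈ F w t i, P.Recordable X F t a) : Execution P Client where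
  gst := gst
  input _ x t := x ∈ X ∧ t = 0
  cert i t := {L | ∃ w, L <+: F w t i}
  view o i t := F (sel o t) t i
  online _ := univ
  view_mem o i t := ⟨_, List.prefix_rfl⟩
  cert_mono := fun i t t' h L ⟨w, hw⟩ => ⟨w, hw.trans (hmono w i t t' h)⟩
  cert_prefix := fun i t L L' ⟨w, hw⟩ h => ⟨w, h.trans hw⟩
  cert_tx := fun i t L x ⟨w, hw⟩ => 
    ⟨i₀, 0, Nat.zero_le _, hF w i t (Entry.tx x) (hw.subset (by simp)), rfl⟩
  cert_epoch := fun i t L τ ⟨w, hw⟩ => hF w i t (Entry.epoch τ) (hw.subset (by simp))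
  cert_msg := fun i t L j m ⟨w, hw⟩ => by
    obtain ⟨t', ht', w', hm⟩ := hF w i t (Entry.msg j m) (hw.subset (by simp))
    exact ⟨t', ht', _, ⟨w', List.prefix_rfl⟩, hm⟩

theorem overlayLedger_congr {e e' : Execution P Client} {c : Client} {t : ℕ} (ho : e.online = e'.online)
    (h : ∀ t' ≤ t, ∀ i, e.view (Sum.inl c) i t' = e'.view (Sum.inl c) i t') :
    e.overlayLedger c t = e'.overlayLedger c t := by
  unfold overlayLedger history
  rw [ho]
  congr 1
  refine List.map_congr_left fun t' ht' => ?_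
  have : t' ≤ t := by
    have := List.mem_range.1 (List.mem_of_mem_filter ht')
    omega
  simp [h t' this]

/-- Everyone sees the same ledgers, the transactions `X` are input at time `0`, and exactly the
chains in `l` are live. -/
def solo (X : List Tx) (l : Fin k → Bool) (i₀ : Fin k) : Execution P Client :=
  ofFamily 0 X (fun _ : Unit => P.evolve X l 0 fun _ _ => []) (fun _ _ => ()) i₀
    (fun _ _ _ _ h => Code.evolve_mono (fun _ _ _ _ => List.prefix_rfl) h)
    (fun _ _ _ _ ha => by
      rcases Code.mem_evolve ha with ⟨_, _, _, h⟩ | ⟨t', ht', h⟩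
      · simp at h
      · exact Code.recordable_of_mem_batch (F := fun _ : Unit => P.evolve X l 0 fun _ _ => [])
          (List.Subset.refl _) ht' () h)

variable {X : List Tx} {l : Fin k → Bool} {i₀ : Fin k}

theorem solo_view (o : Observer k Client) (i : Fin k) (t : ℕ) :
    (solo X l i₀ : Execution P Client).view o i t = P.evolve X l 0 (fun _ _ => []) t i := rfl

theorem chainSafe_solo (i : Fin k) : (solo X l i₀ : Execution P Client).ChainSafe i := by
  refine ⟨?_, fun _ t t' h => Code.evolve_mono (fun _ _ _ _ => List.prefix_rfl) h⟩
  rintro t t' L ⟨_, hL⟩ L' ⟨_, hL'⟩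
  have := fun {s} (hs : s ≤ max t t') => Code.evolve_mono (P := P) (X := X) (l := l) (t₀ := 0)
    (V := fun _ _ => []) (i := i) (fun _ _ _ _ => List.prefix_rfl) hs
  exact Consistent.of_prefix (hL.trans (this (le_max_left _ _))) (hL'.trans (this (le_max_right _ _)))

theorem chainLive_solo {Δ T : ℕ} (hT : 0 < T) {i : Fin k} (hi : l i = true) :
    (solo X l i₀ : Execution P Client).ChainLive Δ T i := by
  have key : ∀ {t t' : ℕ}, t < t' → _ := fun h => Code.batch_subset_evolve (P := P) (X := X)
    (V := fun _ _ => []) (i := i) (fun _ _ _ _ => List.prefix_rfl) hi (Nat.zero_le _) h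
  refine ⟨?_, ?_, ?_⟩
  · rintro x t ⟨hx, -⟩ o t' ht'
    exact key (t := t' - 1) (by omega) (Code.tx_mem_batch.2 hx)
  · intro τ o t' ht'
    exact key (t := t' - 1) (by omega) (Code.epoch_mem_batch.2 (by omega))
  · intro j m t hm o t' ht'
    exact key (t := t) (by omega) (Code.msg_mem_batch.2 hm)

end Execution

namespace OverlayProtocol

variable {k : ℕ} {Tx : Type u} {Client : Type v} {Δ T : ℕ}

/-- Without chains, every transaction is vacuously input to all of them, so liveness demands an
output that validity forbids. -/
theorem exists_fin_of_mem_VL [Nonempty Tx] [Nonempty Client] {P : OverlayProtocol k Tx Client}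
    {p : Guarantee k} (hp : p ∈ P.VL Δ T) : Nonempty (Fin k) := by
  obtain ⟨T', hp⟩ := hp
  by_contra hk
  rw [not_nonempty_iff] at hk
  let e : Execution P.toCode Client :=
    { gst := 0, input := fun _ _ _ => True, cert := fun _ _ => ∅, view := fun _ _ _ => []
      online := fun _ => univ, view_mem := fun _ i => hk.elim i, cert_mono := fun i => hk.elim i
      cert_prefix := fun i => hk.elim i, cert_tx := fun i => hk.elim i
      cert_epoch := fun i => hk.elim i, cert_msg := fun i => hk.elim i }
  have x := Classical.arbitrary Tx
  have c := Classical.arbitrary Client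
  have := hp e (fun i => hk.elim i) (fun i => hk.elim i) x 0 (fun i => hk.elim i) c (0 + T')
    (mem_univ _) le_rfl
  obtain ⟨i, -⟩ := P.valid e c _ (mem_univ _) x this
  exact hk.elim i

/-- If the chains in `l` are live and only `x` is input, clients eventually output copies of `x`. -/
theorem eventually_solo (hT : 0 < T) {P : OverlayProtocol k Tx Client} {p : Guarantee k}
    (hp : p ∈ P.VL Δ T) (i₀ : Fin k) : ∃ T', ∀ x c, ∀ t ≥ T',
      (Execution.solo [x] p.2 i₀ : Execution P.toCode Client).overlayLedger c t ≠ [] ∧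
      ∀ y ∈ (Execution.solo [x] p.2 i₀ : Execution P.toCode Client).overlayLedger c t, y = x := by
  obtain ⟨T', hp⟩ := hp
  refine ⟨T', fun x c t ht => ⟨?_, fun y hy => ?_⟩⟩
  · have := hp (Execution.solo [x] p.2 i₀) (fun i _ => Execution.chainSafe_solo i)
      (fun i hi => Execution.chainLive_solo hT hi) x 0 (fun i => ⟨by simp, rfl⟩) c t (mem_univ _)
      (by simpa [Execution.solo] using ht)
    exact List.ne_nil_of_mem this
  · obtain ⟨_, _, _, h, -⟩ := P.valid (Execution.solo [x] p.2 i₀) c t (mem_univ _) y hy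
    simpa using h

/-- If no chain is live, all ledgers may stay empty, and a client cannot tell the input `x` from the
input `y`. -/
theorem nonempty_of_mem_VL [Nontrivial Tx] [Nonempty Client] (hT : 0 < T)
    {P : OverlayProtocol k Tx Client} {p : Guarantee k} (hp : p ∈ P.VL Δ T) :
    (ind p.2).Nonempty := by
  obtain ⟨i₀⟩ := exists_fin_of_mem_VL hp
  obtain ⟨T', h⟩ := eventually_solo hT hp i₀
  by_contra hne
  have hl : ∀ i, p.2 i = false := fun i => by
    by_contra hi
    exact hne ⟨i, by simpa [ind] using hi⟩
  obtain ⟨x, y, hxy⟩ := exists_pair_ne Tx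
  have c := Classical.arbitrary Client
  obtain ⟨hx, hx'⟩ := h x c T' le_rfl
  obtain ⟨-, hy'⟩ := h y c T' le_rfl
  have : (Execution.solo [x] p.2 i₀ : Execution P.toCode Client).overlayLedger c T' =
      (Execution.solo [y] p.2 i₀ : Execution P.toCode Client).overlayLedger c T' :=
    Execution.overlayLedger_congr rfl fun t _ i => by
      simp only [Execution.solo_view, Code.evolve_of_not_live (hl i)]
  obtain ⟨z, hz⟩ := List.exists_mem_of_ne_nil _ hx
  exact hxy ((hx' z hz).symm.trans (hy' z (this ▸ hz)))

end OverlayProtocol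

/-! ### The split-brain execution -/

namespace Execution

variable {k : ℕ} {Tx : Type u} (P : Code k Tx) {Client : Type v}

/-- The ledgers of the chains in `l₁` are as if only `x` had been input, those of the other chains
as if only `y` had been input and the chains in `l₂` were live. After time `t₀` all chains are
live. -/
def merged (x y : Tx) (l₁ l₂ : Fin k → Bool) (t₀ : ℕ) : ℕ → Fin k → Ledger k Tx P.Msg :=
  P.evolve [x, y] (fun _ => true) t₀ fun t i =>
    if l₁ i then P.evolve [x] l₁ 0 (fun _ _ => []) t i else P.evolve [y] l₂ 0 (fun _ _ => []) t i

/-- The certified ledgers of the split execution. -/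
def splitFamily (x y : Tx) (l₁ l₂ : Fin k → Bool) (t₀ : ℕ) :
    Option Bool → ℕ → Fin k → Ledger k Tx P.Msg
  | some true, t => P.evolve [x] l₁ 0 (fun _ _ => []) (min t t₀)
  -- Both worlds are frozen at `t₀`: `merged` extends them on unforked chains only up to that time,
  -- and nobody sees them later.
  | some false, t => P.evolve [y] l₂ 0 (fun _ _ => []) (min t t₀)
  | none, t => merged P x y l₁ l₂ t₀ t

variable {P} {x y : Tx} {l₁ l₂ : Fin k → Bool} {t₀ : ℕ}

theorem merged_mono {i : Fin k} {t t' : ℕ} (h : t ≤ t') :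
    merged P x y l₁ l₂ t₀ t i <+: merged P x y l₁ l₂ t₀ t' i := by
  refine Code.evolve_mono (fun t t' h _ => ?_) h
  split
  all_goals exact Code.evolve_mono (fun _ _ _ _ => List.prefix_rfl) h

theorem splitFamily_mono (w : Option Bool) (i : Fin k) (t t' : ℕ) (h : t ≤ t') :
    splitFamily P x y l₁ l₂ t₀ w t i <+: splitFamily P x y l₁ l₂ t₀ w t' i := by
  rcases w with _ | _ | _
  · exact merged_mono h
  all_goals exact Code.evolve_mono (fun _ _ _ _ => List.prefix_rfl) (min_le_min_right _ h)

theorem splitFamily_recordable (w : Option Bool) (i : Fin k) (t : ℕ) (a : Entry k Tx P.Msg)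
    (ha : a ∈ splitFamily P x y l₁ l₂ t₀ w t i) :
    P.Recordable [x, y] (splitFamily P x y l₁ l₂ t₀) t a := by
  have key₁ : ∀ s ≤ t, s ≤ t₀ → a ∈ P.evolve [x] l₁ 0 (fun _ _ => []) s i →
      P.Recordable [x, y] (splitFamily P x y l₁ l₂ t₀) t a := by
    intro s hs hs₀ ha
    rcases Code.mem_evolve ha with ⟨_, _, _, h⟩ | ⟨t', ht', h⟩
    · simp at h
    · refine Code.recordable_of_mem_batch (X := [x]) (t := t') (by simp) (by omega) (some true) ?_
      simpa only [splitFamily, min_eq_left (show t' ≤ t₀ by omega)] using h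
  have key₂ : ∀ s ≤ t, s ≤ t₀ → a ∈ P.evolve [y] l₂ 0 (fun _ _ => []) s i →
      P.Recordable [x, y] (splitFamily P x y l₁ l₂ t₀) t a := by
    intro s hs hs₀ ha
    rcases Code.mem_evolve ha with ⟨_, _, _, h⟩ | ⟨t', ht', h⟩
    · simp at h
    · refine Code.recordable_of_mem_batch (X := [y]) (t := t') (by simp) (by omega) (some false) ?_
      simpa only [splitFamily, min_eq_left (show t' ≤ t₀ by omega)] using h
  rcases w with _ | _ | _
  · rcases Code.mem_evolve ha with ⟨s, hs, hs₀, h⟩ | ⟨t', ht', h⟩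
    · split at h
      · exact key₁ s hs hs₀ h
      · exact key₂ s hs hs₀ h
    · exact Code.recordable_of_mem_batch (List.Subset.refl _) ht' none h
  · exact key₂ _ (min_le_left _ _) (min_le_right _ _) ha
  · exact key₁ _ (min_le_left _ _) (min_le_right _ _) ha

open Classical in
/-- Up to time `t₀`, the client `c` sees a world in which only `x` is input and only the chains in
`l₁` are live, and the other clients a world in which only `y` is input and only the chains in `l₂`
are live. -/
noncomputable def split (x y : Tx) (l₁ l₂ : Fin k → Bool) (t₀ : ℕ) (c : Client) (i₀ : Fin k) :
    Execution P Client :=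
  ofFamily t₀ [x, y] (splitFamily P x y l₁ l₂ t₀)
    (fun o t => if t ≤ t₀ then Sum.elim (fun c' => some (decide (c' = c))) (fun _ => none) o
      else none)
    i₀ splitFamily_mono splitFamily_recordable

variable {c : Client} {i₀ : Fin k}

/-- A chain that is not live in both worlds has an empty ledger in at least one of them, so its
ledgers do not conflict. -/
theorem splitFamily_prefix_merged {i : Fin k} (hi : ¬ (l₁ i = true ∧ l₂ i = true))
    (w : Option Bool) (t : ℕ) :
    splitFamily P x y l₁ l₂ t₀ w t i <+: merged P x y l₁ l₂ t₀ t i := by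
  have hm : merged P x y l₁ l₂ t₀ (min t t₀) i <+: merged P x y l₁ l₂ t₀ t i :=
    merged_mono (min_le_left _ _)
  rcases w with _ | _ | _
  · exact List.prefix_rfl
  · refine List.IsPrefix.trans ?_ hm
    rw [merged, Code.evolve_of_le (min_le_right _ _)]
    split
    · rw [splitFamily, Code.evolve_of_not_live (by simp_all)]
      exact List.nil_prefix
    · exact List.prefix_rfl
  · refine List.IsPrefix.trans ?_ hm
    rw [merged, Code.evolve_of_le (min_le_right _ _)]
    split
    · exact List.prefix_rfl
    · rw [splitFamily, Code.evolve_of_not_live (by simp_all)]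
      exact List.nil_prefix

theorem chainSafe_split {i : Fin k} (hi : ¬ (l₁ i = true ∧ l₂ i = true)) :
    (split x y l₁ l₂ t₀ c i₀ : Execution P Client).ChainSafe i := by
  constructor
  · rintro t t' L ⟨w, hL⟩ L' ⟨w', hL'⟩
    exact Consistent.of_prefix (M := merged P x y l₁ l₂ t₀ (max t t') i)
      ((hL.trans (splitFamily_prefix_merged hi w t)).trans (merged_mono (le_max_left _ _)))
      ((hL'.trans (splitFamily_prefix_merged hi w' t')).trans (merged_mono (le_max_right _ _)))
  · intro o t t' h
    by_cases ht' : t' ≤ t₀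
    · simpa [split, ht', h.trans ht'] using splitFamily_mono _ i t t' h
    · simp only [split, ofFamily_view, ht', if_false]
      exact (splitFamily_prefix_merged hi _ t).trans (merged_mono h)

theorem chainLive_split {Δ T : ℕ} (hT : 0 < T) (i : Fin k) :
    (split x y l₁ l₂ t₀ c i₀ : Execution P Client).ChainLive Δ T i := by
  have key : ∀ {t t' : ℕ} (o : Observer k Client), t₀ ≤ t → t < t' →
      P.batch [x, y] (t + 1) (merged P x y l₁ l₂ t₀ t) ⊆
        (split x y l₁ l₂ t₀ c i₀ : Execution P Client).view o i t' := by
    intro t t' o h₀ h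
    simp only [split, ofFamily_view, show ¬ t' ≤ t₀ by omega, if_false]
    refine Code.batch_subset_evolve (fun t t' h _ => ?_) rfl h₀ h
    split
    all_goals exact Code.evolve_mono (fun _ _ _ _ => List.prefix_rfl) h
  refine ⟨?_, ?_, ?_⟩
  · rintro z t ⟨hz, -⟩ o t' ht'
    have : t₀ + T ≤ t' := le_trans (by gcongr; exact le_max_left _ _) ht'
    exact key (t := t' - 1) o (by omega) (by omega) (Code.tx_mem_batch.2 hz)
  · intro τ o t' ht'
    have : max t₀ τ + T ≤ t' := ht'
    exact key (t := t' - 1) o (by omega) (by omega) (Code.epoch_mem_batch.2 (by omega))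
  · intro j m t hm o t' ht'
    have : max t₀ t + Δ + T ≤ t' := ht'
    refine key (t := max t₀ t) o (by omega) (by omega) (Code.msg_mem_batch.2 ?_)
    obtain ⟨L, hL, hmL⟩ := hm
    refine ⟨L, hL.trans ?_, hmL⟩
    -- Unlike the clients, validators see the merged ledgers from the start, so whatever they read
    -- is on the ledgers that continue after `t₀`.
    have hv : (split x y l₁ l₂ t₀ c i₀ : Execution P Client).view (Sum.inr i) j t =
        merged P x y l₁ l₂ t₀ t j := by
      by_cases h : t ≤ t₀ <;> simp [split, h, splitFamily]
    rw [hv]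
    exact merged_mono (le_max_right _ _)

end Execution

/-! ### The upper bound -/

namespace OverlayProtocol

variable {k : ℕ} {Tx : Type u} {Client : Type v} {Δ T : ℕ}

theorem inter_nonempty_of_mem_VS_of_mem_VL [Nontrivial Tx] [Nontrivial Client] (hT : 0 < T)
    {P : OverlayProtocol k Tx Client} {p q₁ q₂ : Guarantee k} (hp : p ∈ P.VS Δ T)
    (h₁ : q₁ ∈ P.VL Δ T) (h₂ : q₂ ∈ P.VL Δ T) : (ind q₁.2 ∩ ind q₂.2 ∩ ind p.1).Nonempty := by
  obtain ⟨i₀⟩ := exists_fin_of_mem_VL h₁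
  obtain ⟨T₁, h₁⟩ := eventually_solo hT h₁ i₀
  obtain ⟨T₂, h₂⟩ := eventually_solo hT h₂ i₀
  obtain ⟨x, y, hxy⟩ := exists_pair_ne Tx
  obtain ⟨c, c', hc⟩ := exists_pair_ne Client
  by_contra hne
  let t₀ := max T₁ T₂
  let e : Execution P.toCode Client := Execution.split x y q₁.2 q₂.2 t₀ c i₀
  have hsafe := (hp e (fun i hi => Execution.chainSafe_split fun h => hne ⟨i, h, hi⟩)
    (fun i _ => Execution.chainLive_split hT i)).1 c c' t₀ t₀ (mem_univ _) (mem_univ _)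
  have e₁ : e.overlayLedger c t₀ =
      (Execution.solo [x] q₁.2 i₀ : Execution P.toCode Client).overlayLedger c t₀ :=
    Execution.overlayLedger_congr rfl fun t ht i => by
      simp [e, Execution.split, ht, Execution.splitFamily, Execution.solo_view]
  have e₂ : e.overlayLedger c' t₀ =
      (Execution.solo [y] q₂.2 i₀ : Execution P.toCode Client).overlayLedger c' t₀ :=
    Execution.overlayLedger_congr rfl fun t ht i => by
      simp [e, Execution.split, ht, Execution.splitFamily, Execution.solo_view, hc.symm]
  obtain ⟨hx, hx'⟩ := h₁ x c t₀ (le_max_left _ _)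
  obtain ⟨hy, hy'⟩ := h₂ y c' t₀ (le_max_right _ _)
  rw [e₁, e₂] at hsafe
  rcases hsafe with h | h
  · obtain ⟨z, hz⟩ := List.exists_mem_of_ne_nil _ hx
    exact hxy ((hx' z hz).symm.trans (hy' z (h.subset hz)))
  · obtain ⟨z, hz⟩ := List.exists_mem_of_ne_nil _ hy
    exact hxy ((hx' z (h.subset hz)).symm.trans (hy' z hz))

theorem exists_admissible_upper [Nontrivial Tx] [Nontrivial Client] (hT : 0 < T)
    (P : OverlayProtocol k Tx Client) :
    ∃ A, Admissible A ∧ P.VS Δ T ⊆ up A.1 ∧ P.VL Δ T ⊆ up A.2 := by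
  -- Liveness sets are kept and their safety parts dropped; the safety sets are then the minimal
  -- sets meeting all pairwise intersections, which makes minimality automatic.
  let Q : Set (Guarantee k) := {q | q.1 = (fun _ => false) ∧ ∃ s, (s, q.2) ∈ P.VL Δ T}
  let S : Set (Fin k → Bool) := {s | ∀ q₁ ∈ Q, ∀ q₂ ∈ Q, (ind q₁.2 ∩ ind q₂.2 ∩ ind s).Nonempty}
  refine ⟨({p | p.2 = (fun _ => false) ∧ Minimal (· ∈ S) p.1}, Q), ⟨fun p hp => hp.1,
    fun q hq => hq.1, ?_, fun q₁ h₁ q₂ h₂ p hp => hp.2.prop q₁ h₁ q₂ h₂, ?_⟩, ?_, ?_⟩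
  · rintro q ⟨-, s, hs⟩
    exact nonempty_of_mem_VL (p := (s, q.2)) hT hs
  · intro p hp s' hs'
    by_contra! h
    exact hp.2.not_lt (fun q₁ h₁ q₂ h₂ => h q₁ h₁ q₂ h₂) hs'
  · intro p hp
    have : p.1 ∈ S := fun q₁ ⟨_, s₁, h₁⟩ q₂ ⟨_, s₂, h₂⟩ =>
      inter_nonempty_of_mem_VS_of_mem_VL (q₁ := (s₁, q₁.2)) (q₂ := (s₂, q₂.2)) hT hp h₁ h₂
    obtain ⟨s, hs, hmin⟩ := (Set.toFinite S).exists_le_minimal this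
    exact ⟨(s, fun _ => false), ⟨rfl, hmin⟩, hs, fun _ => Bool.false_le _⟩
  · intro q hq
    exact ⟨(fun _ => false, q.2), ⟨rfl, q.1, hq⟩, fun _ => Bool.false_le _, le_rfl⟩

end OverlayProtocol

/-! ### Full-information contracts and what a ledger reveals -/

/-- A message of the full-information contract: the ledger of the sending chain. -/
inductive Report (k : ℕ) (Tx : Type u) : Type u
  | mk (L : List (Entry k Tx (Report k Tx)))

abbrev ReportLedger (k : ℕ) (Tx : Type u) : Type u := Ledger k Tx (Report k Tx)

/-- A collection of ledgers for each chain. -/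
abbrev Knowledge (k : ℕ) (Tx : Type u) : Type u := Fin k → ReportLedger k Tx → Prop

section Knowledge

variable {k : ℕ} {Tx : Type u}

/-- `Knows i L j L'`: the ledger `L` of chain `i` reveals, possibly through nested reports, that
`L'` is a ledger of chain `j`. -/
inductive Knows : Fin k → ReportLedger k Tx → Knowledge k Tx
  | own {i : Fin k} {L L' : ReportLedger k Tx} : L' <+: L → Knows i L i L'
  | report {i j n : Fin k} {L M N : ReportLedger k Tx} :
      Entry.msg j (Report.mk M) ∈ L → Knows j M n N → Knows i L n N

theorem Knows.of_prefix {i : Fin k} {L L' : ReportLedger k Tx} (h : L <+: L') :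
    Knows i L ≤ Knows i L' := by
  rintro j N (h' | ⟨hm, hN⟩)
  · exact .own (h'.trans h)
  · exact .report (h.subset hm) hN

theorem Knows.trans {i j : Fin k} {L M : ReportLedger k Tx} (h : Knows i L j M) :
    Knows j M ≤ Knows i L := by
  induction h with
  | own h => exact Knows.of_prefix h
  | report hm _ ih => exact fun n N hN => .report hm (ih n N hN)

namespace Knowledge

/-- Chain `j` is provably unsafe. -/
def Exposed (K : Knowledge k Tx) (j : Fin k) : Prop :=
  ∃ L L', K j L ∧ K j L' ∧ ¬ Consistent L L'

def Closed (K : Knowledge k Tx) : Prop := ∀ i L, K i L → Knows i L ≤ K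

variable {K K' : Knowledge k Tx}

theorem Exposed.mono (h : K ≤ K') {j : Fin k} : K.Exposed j → K'.Exposed j :=
  fun ⟨L, L', hL, hL', hc⟩ => ⟨L, L', h _ _ hL, h _ _ hL', hc⟩

theorem consistent_of_not_exposed {j : Fin k} (h : ¬ K.Exposed j) {L L' : ReportLedger k Tx}
    (hL : K j L) (hL' : K j L') : Consistent L L' := by
  by_contra hc
  exact h ⟨L, L', hL, hL', hc⟩

end Knowledge

/-- Some epoch from `τ` on is recorded in `L`. -/
def Reaches (τ : ℕ) (L : ReportLedger k Tx) : Prop := ∃ τ' ≥ τ, Entry.epoch τ' ∈ L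

/-- `L` ends with the first mark of an epoch from `τ` on. -/
def IsCut (τ : ℕ) (L : ReportLedger k Tx) : Prop :=
  Reaches τ L ∧ ∀ L', L' <+: L → Reaches τ L' → L' = L

theorem Reaches.of_prefix {τ : ℕ} {L L' : ReportLedger k Tx} (h : Reaches τ L) (hL : L <+: L') :
    Reaches τ L' :=
  let ⟨τ', hτ, hm⟩ := h
  ⟨τ', hτ, hL.subset hm⟩

/-- This is why `Reaches` admits every epoch from `τ` on: a late snapshot contains the cuts of all
earlier slots. -/
theorem Reaches.anti {τ τ' : ℕ} {L : ReportLedger k Tx} (h : Reaches τ L) (hτ : τ' ≤ τ) :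
    Reaches τ' L :=
  let ⟨σ, hσ, hm⟩ := h
  ⟨σ, hτ.trans hσ, hm⟩

theorem Reaches.exists_isCut {τ : ℕ} {L : ReportLedger k Tx} (h : Reaches τ L) :
    ∃ C, C <+: L ∧ IsCut τ C := by
  by_cases hc : IsCut τ L
  · exact ⟨L, List.prefix_rfl, hc⟩
  · obtain ⟨L', hL', hr, hne⟩ : ∃ L', L' <+: L ∧ Reaches τ L' ∧ L' ≠ L := by
      by_contra! hall
      exact hc ⟨h, hall⟩
    have : L'.length < L.length :=
      hL'.length_le.lt_of_ne fun he => hne (hL'.eq_of_length he)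
    obtain ⟨C, hC, hcut⟩ := hr.exists_isCut
    exact ⟨C, hC.trans hL', hcut⟩
termination_by L.length

/-- A chain without conflicting ledgers has a single state per slot, hence cannot vote in two ways.
-/
theorem IsCut.eq {τ : ℕ} {C C' : ReportLedger k Tx} (h : IsCut τ C) (h' : IsCut τ C')
    (hc : Consistent C C') : C = C' := by
  rcases hc with hc | hc
  · exact h'.2 C hc h.1
  · exact (h.2 C' hc h'.1).symm

/-- The transactions recorded in a ledger. -/
def txs (L : ReportLedger k Tx) : List Tx :=
  L.filterMap fun a => match a with
    | .tx x => some x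
    | _ => none

theorem mem_txs {x : Tx} {L : ReportLedger k Tx} : x ∈ txs L ↔ Entry.tx x ∈ L := by
  simp only [txs, List.mem_filterMap]
  constructor
  · rintro ⟨a, ha, hx⟩
    cases a <;> simp_all
  · exact fun h => ⟨_, h, rfl⟩

end Knowledge

/-! ### A consensus protocol evaluated on knowledge -/

/-- The parameters of the consensus protocol: the quorums, the leader of each phase, and the start
of each slot, where phase `v` consists of the slots `3 * v` (proposal), `3 * v + 1` (votes) and
`3 * v + 2` (commit votes). -/
structure Consensus (k : ℕ) where
  quorums : Set (Set (Fin k))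
  leader : ℕ → Fin k
  slot : ℕ → ℕ

namespace Consensus

variable {k : ℕ} {Tx : Type u} (R : Consensus k)

/-- The proposal `B` of phase `v` reports the state of a quorum at the end of the preceding
phase. -/
def Justified (v : ℕ) (B : ReportLedger k Tx) : Prop :=
  ∃ l ∈ R.quorums, ∀ j ∈ l, ∃ C, Knows (R.leader v) B j C ∧ Reaches (R.slot (3 * v - 1)) C

/-- The ledger `C` of chain `j` is a vote for the proposal `B` of phase `v`. -/
def IsVote (v : ℕ) (j : Fin k) (C B : ReportLedger k Tx) : Prop :=
  IsCut (R.slot (3 * v + 1)) C ∧ R.Justified v B ∧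
    ∀ B', Knows j C (R.leader v) B' → IsCut (R.slot (3 * v)) B' → B' = B

/-- All chains of a quorum have voted for the proposal `B` of phase `v`, or are provably unsafe. -/
def Certified (K : Knowledge k Tx) (v : ℕ) (B : ReportLedger k Tx) : Prop :=
  K (R.leader v) B ∧ IsCut (R.slot (3 * v)) B ∧
    ∃ l ∈ R.quorums, ∀ j ∈ l, K.Exposed j ∨
      ∃ C, K j C ∧ Knows j C (R.leader v) B ∧ R.IsVote v j C B

/-- All chains of a quorum know in time that the proposal `B` of phase `v` is certified, or are
provably unsafe. -/
def Committed (K : Knowledge k Tx) (v : ℕ) (B : ReportLedger k Tx) : Prop :=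
  K (R.leader v) B ∧ IsCut (R.slot (3 * v)) B ∧
    ∃ l ∈ R.quorums, ∀ j ∈ l, K.Exposed j ∨
      ∃ C, K j C ∧ IsCut (R.slot (3 * v + 2)) C ∧ R.Certified (Knows j C) v B

/-- `B'`, proposed in phase `w`, is the latest certified proposal known to the proposal `B` of
phase `v`. -/
def IsParent (v : ℕ) (B : ReportLedger k Tx) (w : ℕ) (B' : ReportLedger k Tx) : Prop :=
  w < v ∧ R.Certified (Knows (R.leader v) B) w B' ∧
    ∀ w' < v, ∀ B'', R.Certified (Knows (R.leader v) B) w' B'' → w' ≤ w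

open Classical in
/-- The overlay ledger that ends with the proposal `B` of phase `v`. -/
noncomputable def order (v : ℕ) (B : ReportLedger k Tx) : List Tx :=
  (if h : ∃ p : ℕ × ReportLedger k Tx, R.IsParent v B p.1 p.2 then
    order h.choose.1 h.choose.2 else []) ++ txs B
termination_by v
decreasing_by exact h.choose_spec.1

variable {R} {K K' : Knowledge k Tx} {v w : ℕ} {B B' : ReportLedger k Tx}

/-- Further knowledge may expose a voter but never retracts its vote, since exposed chains count as
supporters and a vote depends on the voter's ledger alone. -/
theorem Certified.mono (h : K ≤ K') : R.Certified K v B → R.Certified K' v B :=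
  fun ⟨hK, hcut, l, hl, hv⟩ => ⟨h _ _ hK, hcut, l, hl, fun j hj => (hv j hj).imp
    (Knowledge.Exposed.mono h) fun ⟨C, hC, hC'⟩ => ⟨C, h _ _ hC, hC'⟩⟩

theorem Committed.mono (h : K ≤ K') : R.Committed K v B → R.Committed K' v B :=
  fun ⟨hK, hcut, l, hl, hv⟩ => ⟨h _ _ hK, hcut, l, hl, fun j hj => (hv j hj).imp
    (Knowledge.Exposed.mono h) fun ⟨C, hC, hC'⟩ => ⟨C, h _ _ hC, hC'⟩⟩

theorem exists_isParent (hw : w < v) (hB' : R.Certified (Knows (R.leader v) B) w B') :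
    ∃ p : ℕ × ReportLedger k Tx, R.IsParent v B p.1 p.2 := by
  classical
  let p : ℕ → Prop := fun w => w < v ∧ ∃ B', R.Certified (Knows (R.leader v) B) w B'
  have hp : p w := ⟨hw, B', hB'⟩
  obtain ⟨h, B'', hB''⟩ : p (Nat.findGreatest p v) := Nat.findGreatest_spec hw.le hp
  exact ⟨(_, B''), h, hB'', fun w' hw' C hC => Nat.le_findGreatest hw'.le ⟨hw', C, hC⟩⟩

theorem order_eq_of_certified (hw : w < v) (hB' : R.Certified (Knows (R.leader v) B) w B') :
    ∃ w' B'', R.IsParent v B w' B'' ∧ R.order v B = R.order w' B'' ++ txs B := by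
  have h := exists_isParent hw hB'
  refine ⟨_, _, h.choose_spec, ?_⟩
  rw [order, dif_pos h]

theorem txs_subset_order : txs B ⊆ R.order v B := by
  rw [order]
  exact List.subset_append_right _ _

/-- Parents are known to their children, so the whole ordered history is revealed by the last
proposal; validity rests on this. -/
theorem exists_knows_of_mem_order {x : Tx} (hx : x ∈ R.order v B) :
    ∃ j L, Knows (R.leader v) B j L ∧ Entry.tx x ∈ L := by
  induction v using Nat.strong_induction_on generalizing B with
  | _ v ih =>
    rw [order, List.mem_append] at hx
    rcases hx with hx | hx
    · split at hx
      · rename_i h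
        obtain ⟨j, L, hL, hx⟩ := ih _ h.choose_spec.1 hx
        exact ⟨j, L, h.choose_spec.2.1.1.trans _ _ hL, hx⟩
      · simp at hx
    · exact ⟨_, B, .own List.prefix_rfl, mem_txs.1 hx⟩

/-! #### Agreement -/

section Agreement

variable {s : Set (Fin k)} (hR : ∀ l₁ ∈ R.quorums, ∀ l₂ ∈ R.quorums, (l₁ ∩ l₂ ∩ s).Nonempty)

include hR

theorem Certified.unique (hs : ∀ j ∈ s, ¬ K.Exposed j) (h : R.Certified K v B)
    (h' : R.Certified K v B') : B = B' := by
  obtain ⟨-, hB, l, hl, hv⟩ := h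
  obtain ⟨-, -, l', hl', hv'⟩ := h'
  obtain ⟨j, ⟨hj, hj'⟩, hjs⟩ := hR l hl l' hl'
  obtain ⟨C, hC, hCB, hCv⟩ := (hv j hj).resolve_left (hs j hjs)
  obtain ⟨C', hC', -, hCv'⟩ := (hv' j hj').resolve_left (hs j hjs)
  obtain rfl := hCv.1.eq hCv'.1 (Knowledge.consistent_of_not_exposed (hs j hjs) hC hC')
  exact hCv'.2.2 B hCB hB

theorem Certified.justified (hs : ∀ j ∈ s, ¬ K.Exposed j) (h : R.Certified K v B) :
    R.Justified v B := by
  obtain ⟨-, -, l, hl, hv⟩ := h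
  obtain ⟨j, ⟨hj, -⟩, hjs⟩ := hR l hl l hl
  obtain ⟨C, -, -, hC⟩ := (hv j hj).resolve_left (hs j hjs)
  exact hC.2.1

theorem Committed.certified (hK : K.Closed) (hs : ∀ j ∈ s, ¬ K.Exposed j)
    (h : R.Committed K v B) : R.Certified K v B := by
  obtain ⟨-, -, l, hl, hv⟩ := h
  obtain ⟨j, ⟨hj, -⟩, hjs⟩ := hR l hl l hl
  obtain ⟨C, hC, -, hB⟩ := (hv j hj).resolve_left (hs j hjs)
  exact hB.mono (hK j C hC)

/-- A certified proposal of a phase after `v` knows that the committed proposal of phase `v` is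
certified. -/
theorem Committed.certified_knows (hslot : Monotone R.slot) (hK : K.Closed)
    (hs : ∀ j ∈ s, ¬ K.Exposed j) (h : R.Committed K v B) (hw : v < w)
    (h' : R.Certified K w B') : R.Certified (Knows (R.leader w) B') v B := by
  obtain ⟨l', hl', hst⟩ := h'.justified hR hs
  obtain ⟨-, -, l, hl, hv⟩ := h
  obtain ⟨j, ⟨hj, hj'⟩, hjs⟩ := hR l hl l' hl'
  obtain ⟨C, hC, hcut, hB⟩ := (hv j hj).resolve_left (hs j hjs)
  obtain ⟨D, hD, hr⟩ := hst j hj'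
  obtain ⟨C', hC', hcut'⟩ :=
    (hr.anti (hslot (show 3 * v + 2 ≤ 3 * w - 1 by omega))).exists_isCut
  have hknow : Knows (R.leader w) B' j C' := hD.trans _ _ (.own hC')
  obtain rfl := hcut.eq hcut'
    (Knowledge.consistent_of_not_exposed (hs j hjs) hC (hK _ _ h'.1 _ _ hknow))
  exact hB.mono hknow.trans

theorem Committed.order_prefix_of_lt (hslot : Monotone R.slot) (hK : K.Closed)
    (hs : ∀ j ∈ s, ¬ K.Exposed j) (h : R.Committed K v B) (hw : v < w)
    (h' : R.Certified K w B') : R.order v B <+: R.order w B' := by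
  induction w using Nat.strong_induction_on generalizing B' with
  | _ w ih =>
    have hcert := h.certified_knows hR hslot hK hs hw h'
    -- The parent of `B'` is the latest certificate it knows, so its phase `u` is at least `v`:
    -- descend along parents until phase `v`, where certificates are unique.
    obtain ⟨u, D, ⟨hu, hD, hmax⟩, heq⟩ := order_eq_of_certified hw hcert
    have hDK : R.Certified K u D := hD.mono (hK _ _ h'.1)
    rw [heq]
    refine List.IsPrefix.trans ?_ (List.prefix_append _ _)
    rcases (hmax v hw B hcert).lt_or_eq with hlt | rfl
    · exact ih u hu hlt hDK
    · rw [(h.certified hR hK hs).unique hR hs hDK]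

theorem Committed.order_prefix (hslot : Monotone R.slot) (hK : K.Closed)
    (hs : ∀ j ∈ s, ¬ K.Exposed j) (h : R.Committed K v B) (hw : v ≤ w)
    (h' : R.Committed K w B') : R.order v B <+: R.order w B' := by
  have hc := h'.certified hR hK hs
  rcases hw.lt_or_eq with hlt | rfl
  · exact h.order_prefix_of_lt hR hslot hK hs hlt hc
  · rw [(h.certified hR hK hs).unique hR hs hc]

end Agreement

/-! #### The overlay protocol -/

/-- `B` is committed in phase `v`, and nothing is committed in later phases. -/
def IsLast (R : Consensus k) (K : Knowledge k Tx) (v : ℕ) (B : ReportLedger k Tx) : Prop :=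
  R.Committed K v B ∧ ∀ v' B', R.Committed K v' B' → v' ≤ v

/-- What a client knows that has had the views in `H`. -/
def knowledge (H : List (ℕ × (Fin k → ReportLedger k Tx))) : Knowledge k Tx :=
  fun j L => ∃ p ∈ H, ∃ i, Knows i (p.2 i) j L

open Classical in
/-- The overlay ledger ends with the latest committed proposal. If each of the sets in `S` contains
a provably unsafe chain, it consists of all transactions seen so far. -/
noncomputable def output (R : Consensus k) (S : Set (Set (Fin k)))
    (H : List (ℕ × (Fin k → ReportLedger k Tx))) : List Tx :=
  if ∀ s ∈ S, ∃ j ∈ s, (knowledge H).Exposed j then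
    H.flatMap fun p => (List.finRange k).flatMap fun i => txs (p.2 i)
  else if h : ∃ p : ℕ × ReportLedger k Tx, R.IsLast (knowledge H) p.1 p.2 then
    R.order h.choose.1 h.choose.2
  else []

variable (R) (S : Set (Set (Fin k)))

@[reducible]
noncomputable def code (Tx : Type u) : Code k Tx where
  Msg := Report k Tx
  emit _ L := [Report.mk L]
  read := R.output S

theorem knowledge_closed (H : List (ℕ × (Fin k → ReportLedger k Tx))) : (knowledge H).Closed :=
  fun _ _ ⟨p, hp, i, h⟩ _ _ hN => ⟨p, hp, i, h.trans _ _ hN⟩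

variable {R S} {Client : Type v}

/-- Reports are sound: a recorded report was emitted while executing a certified ledger, and what it
contains is a prefix of that ledger. -/
theorem cert_of_knows (e : Execution (R.code S Tx) Client) {i j : Fin k}
    {L L' : ReportLedger k Tx} (h : Knows i L j L') {t : ℕ} (hL : L ∈ e.cert i t) :
    L' ∈ e.cert j t := by
  induction h generalizing t with
  | own h => exact e.cert_prefix _ _ _ _ hL h
  | @report i j n L M N hm _ ih =>
    obtain ⟨L₁, L₂, rfl⟩ := List.append_of_mem hm
    obtain ⟨t', ht', N', hN', M', hM', hmem⟩ := e.cert_msg i t L₁ j (Report.mk M)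
      (e.cert_prefix _ _ _ _ hL ⟨L₂, by simp⟩)
    obtain rfl : M = M' := by simpa using hmem
    exact ih (e.cert_mono _ _ _ ht'.le (e.cert_prefix _ _ _ _ hN' hM'))

theorem cert_of_knowledge (e : Execution (R.code S Tx) Client) {c : Client} {t : ℕ} {j : Fin k}
    {L : ReportLedger k Tx} (h : knowledge (e.history c t) j L) : L ∈ e.cert j t := by
  obtain ⟨p, hp, i, hL⟩ := h
  obtain ⟨t', ht', rfl⟩ := List.mem_map.1 hp
  have : t' ≤ t := by
    have := List.mem_range.1 (List.mem_of_mem_filter ht')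
    omega
  exact cert_of_knows e hL (e.cert_mono _ _ _ this (e.view_mem _ _ _))

theorem input_of_mem_cert {P : Code k Tx} (e : Execution P Client) {i : Fin k} {t : ℕ}
    {L : Ledger k Tx P.Msg} (hL : L ∈ e.cert i t) {x : Tx} (hx : Entry.tx x ∈ L) :
    ∃ j, ∃ t' ≤ t, e.input j x t' := by
  obtain ⟨L₁, L₂, rfl⟩ := List.append_of_mem hx
  exact e.cert_tx i t L₁ x (e.cert_prefix _ _ _ _ hL ⟨L₂, by simp⟩)

theorem le_of_reaches (e : Execution (R.code S Tx) Client) {i : Fin k} {t τ : ℕ}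
    {L : ReportLedger k Tx} (hL : L ∈ e.cert i t) (h : Reaches τ L) : τ ≤ t := by
  obtain ⟨τ', hτ, hm⟩ := h
  obtain ⟨L₁, L₂, rfl⟩ := List.append_of_mem hm
  exact le_trans hτ (e.cert_epoch i t L₁ τ' (e.cert_prefix _ _ _ _ hL ⟨L₂, by simp⟩))

theorem mem_history {P : Code k Tx} (e : Execution P Client) {c : Client} {t t' : ℕ}
    (ho : t ∈ e.online c) (h : t ≤ t') :
    (t, fun i => e.view (Sum.inl c) i t) ∈ e.history c t' := by
  classical
  refine List.mem_map.2 ⟨t, List.mem_filter.2 ⟨List.mem_range.2 (by omega), ?_⟩, rfl⟩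
  simpa using ho

theorem history_subset {P : Code k Tx} (e : Execution P Client) {c : Client} {t t' : ℕ}
    (h : t ≤ t') : e.history c t ⊆ e.history c t' := by
  classical
  intro p hp
  obtain ⟨σ, hσ, rfl⟩ := List.mem_map.1 hp
  obtain ⟨h₁, h₂⟩ := List.mem_filter.1 hσ
  have := List.mem_range.1 h₁
  exact List.mem_map.2 ⟨σ, List.mem_filter.2 ⟨List.mem_range.2 (by omega), h₂⟩, rfl⟩

theorem exists_cert_of_mem_output (e : Execution (R.code S Tx) Client) {c : Client} {t : ℕ} {x : Tx}
    (hx : x ∈ R.output S (e.history c t)) : ∃ i, ∃ L ∈ e.cert i t, Entry.tx x ∈ L := by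
  unfold output at hx
  split at hx
  · simp only [List.mem_flatMap, mem_txs] at hx
    obtain ⟨p, hp, i, -, hx⟩ := hx
    exact ⟨i, p.2 i, cert_of_knowledge e ⟨p, hp, i, .own List.prefix_rfl⟩, hx⟩
  · split at hx
    · rename_i h
      obtain ⟨j, L, hL, hx⟩ := exists_knows_of_mem_order hx
      exact ⟨j, L, cert_of_knows e hL (cert_of_knowledge e h.choose_spec.1.1), hx⟩
    · simp at hx

variable (R S Client) in
noncomputable def protocol (Tx : Type u) : OverlayProtocol k Tx Client where
  toCode := R.code S Tx
  valid e c t _ x hx := by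
    obtain ⟨i, L, hL, hx⟩ := exists_cert_of_mem_output e hx
    exact input_of_mem_cert e hL hx

/-! #### Safety -/

theorem isLast_or_output_eq_nil {H : List (ℕ × (Fin k → ReportLedger k Tx))}
    {s : Set (Fin k)} (hs : s ∈ S) (he : ∀ j ∈ s, ¬ (knowledge H).Exposed j) :
    (∃ v B, R.IsLast (knowledge H) v B ∧ R.output S H = R.order v B) ∨
      (¬ ∃ p : ℕ × ReportLedger k Tx, R.IsLast (knowledge H) p.1 p.2) ∧ R.output S H = [] := by
  have h₀ : ¬ ∀ s ∈ S, ∃ j ∈ s, (knowledge H).Exposed j := fun h =>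
    let ⟨j, hj, hj'⟩ := h s hs
    he j hj hj'
  by_cases h : ∃ p : ℕ × ReportLedger k Tx, R.IsLast (knowledge H) p.1 p.2
  · refine Or.inl ⟨_, _, h.choose_spec, ?_⟩
    rw [output, if_neg h₀, dif_pos h]
  · exact Or.inr ⟨h, by rw [output, if_neg h₀, dif_neg h]⟩

/-- A proposal of phase `v` records an epoch not before `slot (3 * v)`, which must have started;
this bounds the committed phases. -/
theorem exists_isLast (e : Execution (R.code S Tx) Client) (hslot : ∀ n, n ≤ R.slot n) {c : Client}
    {t : ℕ} (h : R.Committed (knowledge (e.history c t)) v B) :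
    ∃ p : ℕ × ReportLedger k Tx, R.IsLast (knowledge (e.history c t)) p.1 p.2 := by
  classical
  let p : ℕ → Prop := fun v => ∃ B, R.Committed (knowledge (e.history c t)) v B
  have hle : ∀ v, p v → v ≤ t := fun v ⟨B, hB⟩ => by
    have := le_of_reaches e (cert_of_knowledge e hB.1) hB.2.1.1
    have := hslot (3 * v)
    omega
  obtain ⟨B', hB'⟩ : p (Nat.findGreatest p t) := Nat.findGreatest_spec (hle v ⟨B, h⟩) ⟨B, h⟩
  exact ⟨(_, B'), hB', fun v' C hC => Nat.le_findGreatest (hle _ ⟨C, hC⟩) ⟨C, hC⟩⟩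

section Safety

variable {s : Set (Fin k)} (hR : ∀ l₁ ∈ R.quorums, ∀ l₂ ∈ R.quorums, (l₁ ∩ l₂ ∩ s).Nonempty)

include hR

theorem overlaySafe (hslot : Monotone R.slot) (hslot' : ∀ n, n ≤ R.slot n) (hs : s ∈ S)
    (e : Execution (R.code S Tx) Client) (he : ∀ i ∈ s, e.ChainSafe i) : e.OverlaySafe := by
  -- All clients are compared inside the union of all certified ledgers, where the chains of `s` are
  -- still not exposed; commitments move up to it by monotonicity.
  let K : Knowledge k Tx := fun i L => ∃ t, L ∈ e.cert i t
  have hK : K.Closed := fun i L ⟨t, ht⟩ j L' h => ⟨t, cert_of_knows e h ht⟩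
  have hKs : ∀ j ∈ s, ¬ K.Exposed j := fun j hj ⟨L, L', ⟨t, hL⟩, ⟨t', hL'⟩, hc⟩ =>
    hc ((he j hj).1 t t' L hL L' hL')
  have hle : ∀ c t, knowledge (e.history c t) ≤ K := fun c t j L h => ⟨t, cert_of_knowledge e h⟩
  have hout := fun c t => isLast_or_output_eq_nil (R := R) (H := e.history c t) hs
    fun j hj h => hKs j hj (h.mono (hle c t))
  constructor
  · intro c c' t t' _ _
    change Consistent (R.output S _) (R.output S _)
    rcases hout c t with ⟨v, B, hB, h⟩ | ⟨-, h⟩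
    · rcases hout c' t' with ⟨v', B', hB', h'⟩ | ⟨-, h'⟩
      · rw [h, h']
        have hc := hB.1.mono (hle c t)
        have hc' := hB'.1.mono (hle c' t')
        exact (le_total v v').imp (fun hv => hc.order_prefix hR hslot hK hKs hv hc')
          (fun hv => hc'.order_prefix hR hslot hK hKs hv hc)
      · exact Or.inr (h' ▸ List.nil_prefix)
    · exact Or.inl (h ▸ List.nil_prefix)
  · intro c t t' _ _ htt'
    change R.output S _ <+: R.output S _
    have hkn : knowledge (e.history c t) ≤ knowledge (e.history c t') :=
      fun j L ⟨p, hp, h⟩ => ⟨p, history_subset e htt' hp, h⟩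
    rcases hout c t with ⟨v, B, hB, h⟩ | ⟨-, h⟩
    · have hB' := hB.1.mono hkn
      rcases hout c t' with ⟨v', B', hB'', h'⟩ | ⟨hn, -⟩
      · rw [h, h']
        exact (hB.1.mono (hle c t)).order_prefix hR hslot hK hKs (hB''.2 v B hB')
          (hB''.1.mono (hle c t'))
      · exact absurd (exists_isLast e hslot' hB') hn
    · exact h ▸ List.nil_prefix

end Safety

/-! #### Liveness -/

section Liveness

variable {e : Execution (R.code S Tx) Client} {Δ T : ℕ}

theorem knows_view {j : Fin k} (hj : e.ChainLive Δ T j) (a : Fin k) (o : Observer k Client)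
    {t t' : ℕ} (h : max e.gst t + Δ + T ≤ t') :
    Knows j (e.view o j t') a (e.view (Sum.inr j) a t) :=
  .report (hj.msg a (Report.mk (e.view (Sum.inr j) a t)) t
    ⟨_, List.prefix_rfl, List.mem_singleton.2 rfl⟩ o t' h) (.own List.prefix_rfl)

theorem reaches_view {j : Fin k} (hj : e.ChainLive Δ T j) (o : Observer k Client) {τ t : ℕ}
    (h : max e.gst τ + T ≤ t) : Reaches τ (e.view o j t) :=
  ⟨τ, le_rfl, hj.epoch τ o t h⟩

/-- A live chain that is not provably unsafe has, in its cut at `τ`, all that its validators had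
seen before `τ`. -/
theorem exists_isCut_of_chainLive {j : Fin k} (hj : e.ChainLive Δ T j) {K : Knowledge k Tx}
    {o : Observer k Client} {τ t : ℕ} (hK : Knows j (e.view o j t) ≤ K) (hτ : e.gst < τ)
    (ht : τ + Δ + T ≤ t) (hne : ¬ K.Exposed j) :
    ∃ C, K j C ∧ IsCut τ C ∧ e.view (Sum.inr j) j (τ - 1) <+: C := by
  obtain ⟨C, hC, hcut⟩ := (reaches_view hj o (τ := τ) (t := t) (by omega)).exists_isCut
  have hCK : K j C := hK _ _ (.own hC)
  refine ⟨C, hCK, hcut, ?_⟩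
  -- The chain also receives its own reports, so its validators' view before `τ` is known and
  -- comparable with the cut. It cannot extend the cut, as no epoch from `τ` on has started by `τ -
  -- 1`.
  refine (Knowledge.consistent_of_not_exposed hne (hK _ _ (knows_view hj j o (by omega)))
    hCK).resolve_right fun h => ?_
  have := le_of_reaches e (e.view_mem (Sum.inr j) j (τ - 1)) (hcut.1.of_prefix h)
  omega

theorem exists_committed {l : Set (Fin k)} (hl : l ∈ R.quorums)
    (hlive : ∀ j ∈ l, e.ChainLive Δ T j)
    (hslot : ∀ n, R.slot n + 2 * (Δ + T) + 1 ≤ R.slot (n + 1)) {K : Knowledge k Tx} (hK : K.Closed)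
    {o : Observer k Client} {t : ℕ} (hKt : ∀ j, K j (e.view o j t)) (hv : 0 < v)
    (hi : R.leader v ∈ l) (hne : ¬ K.Exposed (R.leader v)) (hgst : e.gst < R.slot (3 * v - 1))
    (ht : R.slot (3 * v + 2) + Δ + T ≤ t) :
    ∃ B, R.Committed K v B ∧
      e.view (Sum.inr (R.leader v)) (R.leader v) (R.slot (3 * v) - 1) <+: B := by
  have h₀ := hslot (3 * v - 1)
  have h₁ := hslot (3 * v)
  have h₂ := hslot (3 * v + 1)
  rw [show 3 * v - 1 + 1 = 3 * v by omega] at h₀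
  rw [show 3 * v + 1 + 1 = 3 * v + 2 by omega] at h₂
  obtain ⟨B, hB, hBcut, hBpre⟩ := exists_isCut_of_chainLive (hlive _ hi) (hK _ _ (hKt _))
    (τ := R.slot (3 * v)) (by omega) (by omega) hne
  have hjust : R.Justified v B := ⟨l, hl, fun j hj =>
    ⟨_, Knows.of_prefix hBpre _ _ (knows_view (hlive _ hi) j _
      (t := R.slot (3 * v - 1) + T) (by omega)), reaches_view (hlive j hj) _ (by omega)⟩⟩
  have huniq : ∀ B', K (R.leader v) B' → IsCut (R.slot (3 * v)) B' → B' = B := fun B' hB' hcut =>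
    hcut.eq hBcut (Knowledge.consistent_of_not_exposed hne hB' hB)
  -- whoever sees the proposal slot of the leader's ledger sees the proposal
  have hprop : ∀ {j C σ}, K j C → Knows j C (R.leader v) (e.view (Sum.inr j) (R.leader v) σ) →
      R.slot (3 * v) + T ≤ σ → Knows j C (R.leader v) B := fun {j C σ} hC hknow hσ => by
    obtain ⟨B', hB', hcut⟩ := (reaches_view (hlive _ hi) (Sum.inr j) (τ := R.slot (3 * v)) (t := σ)
      (by omega)).exists_isCut
    have hB'C : Knows j C (R.leader v) B' := hknow.trans _ _ (.own hB')
    rwa [huniq B' (hK _ _ hC _ _ hB'C) hcut] at hB'C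
  -- Stated for any `K' ≤ K` because the commit voters judge votes by what their own ledgers reveal,
  -- where fewer chains may be exposed.
  have hvote : ∀ {K' : Knowledge k Tx}, K' ≤ K → ∀ j ∈ l, ∀ {o' t'},
      Knows j (e.view o' j t') ≤ K' → R.slot (3 * v + 1) + Δ + T ≤ t' →
      K'.Exposed j ∨ ∃ C, K' j C ∧ Knows j C (R.leader v) B ∧ R.IsVote v j C B := by
    intro K' hK' j hj o' t' hKj ht'
    refine or_iff_not_imp_left.2 fun hje => ?_
    obtain ⟨C, hC, hcut, hpre⟩ := exists_isCut_of_chainLive (hlive j hj) hKj (by omega) ht' hje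
    refine ⟨C, hC, hprop (hK' _ _ hC) (Knows.of_prefix hpre _ _ (knows_view (hlive j hj) _ _
      (t := R.slot (3 * v) + T) (by omega))) le_rfl, hcut, hjust, fun B' hB' hcut' => ?_⟩
    exact huniq B' (hK _ _ (hK' _ _ hC) _ _ hB') hcut'
  refine ⟨B, ⟨hB, hBcut, l, hl, fun j hj => or_iff_not_imp_left.2 fun hje => ?_⟩, hBpre⟩
  obtain ⟨C, hC, hcut, hpre⟩ := exists_isCut_of_chainLive (hlive j hj) (hK _ _ (hKt j))
    (by omega) ht hje
  -- This fixes the slot length `2 * (Δ + T) + 1`: `Δ + T` until the votes and the voters' own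
  -- reports are on their ledgers, `Δ + T` to relay these ledgers, and one step to precede the next
  -- slot.
  have hCa : ∀ a, Knows j C a (e.view (Sum.inr j) a (R.slot (3 * v + 1) + Δ + T)) := fun a =>
    Knows.of_prefix hpre _ _ (knows_view (hlive j hj) _ _ (by omega))
  refine ⟨C, hC, hcut, hprop hC (hCa _) (by omega), hBcut, l, hl, fun a ha => ?_⟩
  exact hvote (hK _ _ hC) a ha (hCa a).trans le_rfl

theorem mem_output_of_committed (hslot : Monotone R.slot) (hslot' : ∀ n, n ≤ R.slot n)
    (hR : ∀ s ∈ S, ∀ l₁ ∈ R.quorums, ∀ l₂ ∈ R.quorums, (l₁ ∩ l₂ ∩ s).Nonempty) {c : Client} {t : ℕ}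
    {s : Set (Fin k)} (hs : s ∈ S) (he : ∀ j ∈ s, ¬ (knowledge (e.history c t)).Exposed j)
    (h : R.Committed (knowledge (e.history c t)) v B) {x : Tx} (hx : Entry.tx x ∈ B) :
    x ∈ R.output S (e.history c t) := by
  rcases isLast_or_output_eq_nil (R := R) hs he with ⟨v', B', hB', heq⟩ | ⟨hn, -⟩
  · rw [heq]
    exact (h.order_prefix (hR s hs) hslot (knowledge_closed _) he (hB'.2 v B h) hB'.1).subset
      (txs_subset_order (mem_txs.2 hx))
  · exact absurd (exists_isLast e hslot' h) hn

theorem mem_output_of_exposed {c : Client} {t : ℕ} (ht : t ∈ e.online c)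
    (h : ∀ s ∈ S, ∃ j ∈ s, (knowledge (e.history c t)).Exposed j) {x : Tx} {i : Fin k}
    (hx : Entry.tx x ∈ e.view (Sum.inl c) i t) : x ∈ R.output S (e.history c t) := by
  rw [output, if_pos h]
  simp only [List.mem_flatMap, mem_txs]
  exact ⟨_, mem_history e ht le_rfl, i, List.mem_finRange i, hx⟩

end Liveness

end Consensus

/-! ### Every admissible tuple is attained -/

/-- The consensus protocol with rotating leaders and slots of length `2 * (Δ + T) + 1`. -/
def roundRobin {k : ℕ} (hk : 0 < k) (Δ T : ℕ) (quorums : Set (Set (Fin k))) : Consensus k where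
  quorums := quorums
  leader v := ⟨v % k, Nat.mod_lt v hk⟩
  slot n := n * (2 * (Δ + T) + 1)

theorem exists_phase {k : ℕ} (i : Fin k) {δ : ℕ} (hδ : 0 < δ) (M : ℕ) :
    ∃ v, v % k = i ∧ 0 < v ∧ M < (3 * v - 1) * δ ∧ M + δ < 3 * v * δ ∧
      (3 * v + 2) * δ ≤ M + (6 * k + 8) * δ := by
  have hk : 0 < k := i.pos
  -- Phase `q` is the one containing time `M`. The witness is the residue `i` in the first block of
  -- `k` phases starting after phase `q + 2`, so it overshoots by `r ≤ 2 * k` phases.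
  let q := M / (3 * δ)
  have hq : 3 * δ * q ≤ M := Nat.mul_div_le _ _
  have hq' : M < 3 * δ * (q + 1) := Nat.lt_mul_div_succ M (by omega)
  let b := (q + 2) / k
  have hb : k * b ≤ q + 2 := Nat.mul_div_le _ _
  have hb' : q + 2 < k * (b + 1) := Nat.lt_mul_div_succ _ hk
  obtain ⟨r, hr⟩ : ∃ r, k * (b + 1) + i = q + 2 + r := ⟨k * (b + 1) + i - (q + 2), by omega⟩
  have hrk : r ≤ 2 * k := by
    have := i.isLt
    rw [Nat.mul_succ] at hr
    omega
  refine ⟨k * (b + 1) + i, ?_, ?_⟩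
  · rw [Nat.mul_add_mod, Nat.mod_eq_of_lt i.isLt]
  · rw [hr]
    have h₁ : (3 * (q + 2 + r) - 1) * δ = 3 * δ * (q + 1) + (3 * r + 2) * δ := by
      rw [show 3 * (q + 2 + r) - 1 = 3 * q + 3 * r + 5 by omega]
      ring
    have h₂ : 3 * (q + 2 + r) * δ = 3 * δ * (q + 1) + δ + (3 * r + 2) * δ := by ring
    have h₃ : (3 * (q + 2 + r) + 2) * δ = 3 * δ * q + (3 * r + 8) * δ := by ring
    have h₄ : (3 * r + 8) * δ ≤ (6 * k + 8) * δ := Nat.mul_le_mul_right _ (by omega)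
    omega

/-- The overlay protocol whose clients output nothing. -/
def silent (k : ℕ) (Tx : Type u) (Client : Type v) : OverlayProtocol k Tx Client where
  Msg := PUnit
  emit _ _ := []
  read _ := []
  valid e c t _ x hx := by simp [Execution.overlayLedger] at hx

theorem exists_protocol_lower {k : ℕ} {Tx : Type u} {Client : Type v} {Δ T : ℕ}
    {A : Set (Guarantee k) × Set (Guarantee k)} (hA : Admissible A) :
    ∃ Q : OverlayProtocol k Tx Client, up A.1 ⊆ Q.VS Δ T ∧ up A.2 ⊆ Q.VL Δ T := by
  rcases A.2.eq_empty_or_nonempty with hempty | ⟨q₀, hq₀⟩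
  -- Without liveness sets nothing need be output. This also covers `k = 0`, where there is no chain
  -- to lead a phase.
  · refine ⟨silent k Tx Client, fun _ _ e _ _ => ?_, ?_⟩
    · exact ⟨fun _ _ _ _ _ _ => Or.inl List.prefix_rfl, fun _ _ _ _ _ _ => List.prefix_rfl⟩
    · rw [hempty]
      rintro v ⟨w, hw, -⟩
      exact absurd hw (notMem_empty w)
  obtain ⟨i₀, -⟩ := hA.quorum_nonempty q₀ hq₀
  let S : Set (Set (Fin k)) := (fun p => ind p.1) '' A.1
  let R : Consensus k := roundRobin i₀.pos Δ T ((fun q => ind q.2) '' A.2)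
  have hR : ∀ s ∈ S, ∀ l₁ ∈ R.quorums, ∀ l₂ ∈ R.quorums, (l₁ ∩ l₂ ∩ s).Nonempty := by
    rintro _ ⟨p, hp, rfl⟩ _ ⟨q₁, h₁, rfl⟩ _ ⟨q₂, h₂, rfl⟩
    exact hA.intersection q₁ h₁ q₂ h₂ p hp
  have hmono : Monotone R.slot := fun m n h => Nat.mul_le_mul_right _ h
  have hle : ∀ n, n ≤ R.slot n := fun n => Nat.le_mul_of_pos_right n (by omega)
  refine ⟨R.protocol S Client Tx, ?_, ?_⟩
  · rintro p ⟨p₀, hp₀, hle₀⟩ e hs -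
    have hs₀ : ind p₀.1 ∈ S := ⟨p₀, hp₀, rfl⟩
    exact Consensus.overlaySafe (hR _ hs₀) hmono hle hs₀ e
      fun i hi => hs i (ind_mono hle₀.1 hi)
  · rintro q ⟨q₁, hq₁, hle₁⟩
    refine ⟨(6 * k + 8) * (2 * (Δ + T) + 1) + Δ + T, fun e _ hl x t hx c t' ht' hM => ?_⟩
    change x ∈ R.output S (e.history c t')
    have hlive : ∀ j ∈ ind q₁.2, e.ChainLive Δ T j := fun j hj => hl j (ind_mono hle₁.2 hj)
    by_cases hexp : ∀ s ∈ S, ∃ j ∈ s, (Consensus.knowledge (e.history c t')).Exposed j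
    · obtain ⟨i, hi⟩ := hA.quorum_nonempty q₁ hq₁
      exact Consensus.mem_output_of_exposed ht' hexp
        ((hlive i hi).tx x t (hx i) (Sum.inl c) t' (by omega))
    · push Not at hexp
      obtain ⟨s, hs, hne⟩ := hexp
      -- Intersecting the quorum with itself and `s` yields a chain that is live and not exposed to
      -- this client, which is all a successful leader needs.
      obtain ⟨i, ⟨hi, -⟩, his⟩ := hR s hs _ ⟨q₁, hq₁, rfl⟩ _ ⟨q₁, hq₁, rfl⟩
      obtain ⟨v, hvi, hv, h₁, h₂, h₃⟩ :=
        exists_phase i (δ := 2 * (Δ + T) + 1) (by omega) (max e.gst t)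
      obtain rfl : R.leader v = i := Fin.ext hvi
      obtain ⟨B, hB, hpre⟩ := Consensus.exists_committed (R := R) (e := e) (v := v) (o := Sum.inl c)
        (t := t') ⟨q₁, hq₁, rfl⟩ hlive (fun n => by
          change n * (2 * (Δ + T) + 1) + 2 * (Δ + T) + 1 ≤ (n + 1) * (2 * (Δ + T) + 1)
          exact le_of_eq (by ring))
        (Consensus.knowledge_closed (e.history c t'))
        (fun j => ⟨_, Consensus.mem_history e ht' le_rfl, j, .own List.prefix_rfl⟩) hv hi
        (hne _ his) (lt_of_le_of_lt (le_max_left _ _) h₁)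
        (by change (3 * v + 2) * (2 * (Δ + T) + 1) + Δ + T ≤ t'; omega)
      refine Consensus.mem_output_of_committed hmono hle hR hs hne hB (hpre.subset ?_)
      refine (hlive _ hi).tx x t (hx _) _ _ ?_
      change _ ≤ 3 * v * (2 * (Δ + T) + 1) - 1
      omega

end Interchain

theorem mainTheorem12 {k : ℕ} {Tx : Type u} [Nontrivial Tx] {Client : Type v} [Nontrivial Client]
    {Δ T : ℕ} (hΔ : 0 < Δ) (hT : 0 < T) :
    (∀ P : Interchain.OverlayProtocol k Tx Client, P.ParetoOptimal Δ T →
      Interchain.Admissible (P.ES Δ T, P.EL Δ T)) ∧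
    (∀ A : Set (Interchain.Guarantee k) × Set (Interchain.Guarantee k), Interchain.Admissible A →
      ∃ P : Interchain.OverlayProtocol k Tx Client, P.ParetoOptimal Δ T ∧
        Interchain.TupleDominates (P.ES Δ T, P.EL Δ T) A) ∧
    (∀ P : Interchain.OverlayProtocol k Tx Client, P.ParetoOptimal Δ T ↔
      Interchain.Admissible (P.ES Δ T, P.EL Δ T) ∧
        ∀ A : Set (Interchain.Guarantee k) × Set (Interchain.Guarantee k), Interchain.Admissible A →
          Interchain.TupleDominates A (P.ES Δ T, P.EL Δ T) →
            Interchain.TupleDominates (P.ES Δ T, P.EL Δ T) A) := by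
  have upper := Interchain.OverlayProtocol.exists_admissible_upper (k := k) (Tx := Tx)
    (Client := Client) (Δ := Δ) hT
  have lower := fun (A : Set (Interchain.Guarantee k) × _) (hA : Interchain.Admissible A) =>
    Interchain.exists_protocol_lower (Tx := Tx) (Client := Client) (Δ := Δ) (T := T) hA
  exact ⟨fun _ hP => hP.admissible upper lower,
    fun _ hA => Interchain.exists_paretoOptimal_dominating upper lower hA,
    fun P => P.paretoOptimal_iff upper lower⟩
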